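/- Let $n\ge 2$, $\kappa_0>0$, $L=2\pi/\kappa_0$, $\bar\kappa\in\mathbb R$, $C>0$. Let $\mathcal K$ be the set of sequences $(\hat u(k))_{k\in\mathbb Z^n}$ in $\mathbb C^n$ with $\hat u(0)=0$, $\hat u(k)=\overline{\hat u(-k)}$ and $k\cdot\hat u(k)=0$ for all $k$ (the Fourier coefficients of real, mean-zero, divergence-free $L$-periodic fields $u(x)=\sum_k\hat u(k)e^{i\kappa_0k\cdot x}$). For $\sigma\in\mathbb R$ and $\lambda\ge0$ put $$\|u\|_{\lambda,\sigma}=\kappa_0^{\sigma}\sum_{k}e^{\lambda\kappa_0|k|}|k|^{\sigma}|\hat u(k)|,$$ $\|u\|_\sigma=\|u\|_{0,\sigma}$, $V_\sigma=\{u\in\mathcal K:\|u\|_\sigma<\infty\}$, and, for viscosity $\nu>0$, $\|u\|_{\mathcal W}=(\nu\kappa_0)^{-1}\|u\|_0$. For $u\in V_0$ let $\lambda_a(u)=\sup\{\lambda>0:\|u\|_{\lambda,0}<\infty\}\in[0,\infty]$ be the maximal uniform radius of spatial analyticity. Let $B[u,v](k)=i\kappa_0\,\mathcal P_k\sum_{\ell\ne0}(k\cdot\hat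 u(\ell))\hat v(k-\ell)$ with $\mathcal P_kw=w-\big(\tfrac{k}{|k|}\cdot w\big)\tfrac{k}{|k|}$. A weak solution on $[0,T]$ of the Navier--Stokes system with time-independent force $f\in\mathcal K$ and initial value $u_0$ is a function $u\in C([0,T];\mathcal K)$ (continuity in each mode) with $u(0)=u_0$ such that for every $k$ the map $t\mapsto\hat u(k,t)$ is absolutely continuous on $[0,T]$, the series defining $B[u(t),u(t)](k)$ converges absolutely for a.e. $t\in[0,T]$, and $$\tfrac{d}{dt}\hat u(k,t)=-\nu\kappa_0^2|k|^2\hat u(k,t)-B[u(t),u(t)](k)+\hat f(k)\quad\text{for a.e. }t\in[0,T].$$ It is Gevrey regular if $\sup_{0\le t\le T}\|u(t)\|_{\lambda(t),\sigma}<\infty$ for some $\sigma\in\mathbb R$ and some increasing (i.e. nondecreasing) $\lambda:[0,\infty)\to[0,\infty)$ with $\lambda(s+t)\le\lambda(s)+\lambda(t)$ and $\lambda(t)>0$ for $t>0$. **Theorem.** There is a constant $c>0$, depending only on $n,\kappa_0,\bar\kappa,C$, such that the following holds for all $\nu>0$. Let $f\in\mathcal K$ be a time-independent force with finitely many modes,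 namely $\hat f(k)=0$ whenever $|k|>\bar\kappa/\kappa_0$, and let $$G=\frac{\kappa_0^{n/2}}{\nu^2\kappa_0^3}\,\|f\|_{L^2([0,L]^n)}$$ be its Grashof number. If $u_0\in\mathcal K$ satisfies $\|u_0\|_{\mathcal W}\le C\,G^{1/2}$, then for some $0<T^*<(\nu\kappa_0^2)^{-1}$ there exists a weak solution $u\in C([0,T^*];V_0)$ with initial value $u_0$; it is the only weak solution on $[0,T^*]$ with this initial value in $C([0,T^*];V_0)$, it is Gevrey regular, and its radius of analyticity at time $T^*$ satisfies $$\lambda_a(u(T^*))\ \ge\ c\,\kappa_0^{-1}\max\{1,G\}^{-1/2};$$ in particular $\lambda_a(u(T^*))\ge c\,\kappa_0^{-1}G^{-1/2}$ whenever $G\ge1$. -/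

import Mathlib

namespace NavierStokesTorus

noncomputable section

/-- Fourier coefficient sequences `(û(k))` indexed by `k ∈ ℤⁿ`, with values in `ℂⁿ`
(Euclidean norm). -/
abbrev CoeffSeq (n : ℕ) : Type := (Fin n → ℤ) → EuclideanSpace ℂ (Fin n)

/-- Euclidean length `|k|` of a wave vector. -/
def waveAbs {n : ℕ} (k : Fin n → ℤ) : ℝ := Real.sqrt (∑ j, (k j : ℝ) ^ 2)

/-- The bilinear product `k · w = ∑ⱼ kⱼ wⱼ` (no complex conjugation). -/
def waveDot {n : ℕ} (k : Fin n → ℤ) (w : EuclideanSpace ℂ (Fin n)) : ℂ :=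
  ∑ j, (k j : ℂ) * w j

/-- The wave vector `k` seen as an element of `ℂⁿ`. -/
def waveVec {n : ℕ} (k : Fin n → ℤ) : EuclideanSpace ℂ (Fin n) :=
  WithLp.toLp 2 (fun j => (k j : ℂ))

/-- The space `K`: mean zero, real valued, divergence free. -/
def DivFree (n : ℕ) : Set (CoeffSeq n) :=
  {u | u 0 = 0 ∧ (∀ k j, u k j = (starRingEnd ℂ) (u (-k) j)) ∧ ∀ k, waveDot k (u k) = 0}

/-- Symbol of the Helmholtz-Leray projection at the wave vector `k`:
`w ↦ w - (k/|k| · w) k/|k|`. -/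
def leray {n : ℕ} (k : Fin n → ℤ) (w : EuclideanSpace ℂ (Fin n)) :
    EuclideanSpace ℂ (Fin n) :=
  w - (waveDot k w / ((waveAbs k : ℂ) ^ 2)) • waveVec k

/-- The summand `(k · û(ℓ)) v̂(k - ℓ)` of the convolution in the bilinear term. -/
def bilinTerm {n : ℕ} (u v : CoeffSeq n) (k l : Fin n → ℤ) : EuclideanSpace ℂ (Fin n) :=
  waveDot k (u l) • v (k - l)

/-- The Fourier coefficient at `k` of the bilinear term `B[u, v] = ℙ (u · ∇ v)`. -/
def bilin {n : ℕ} (κ₀ : ℝ) (u v : CoeffSeq n) (k : Fin n → ℤ) : EuclideanSpace ℂ (Fin n) :=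
  (Complex.I * (κ₀ : ℂ)) • leray k (∑' l : {l : Fin n → ℤ // l ≠ 0}, bilinTerm u v k l)

/-- The Gevrey norm `‖u‖_{lam, σ} = κ₀^σ ∑ₖ e^{lam κ₀ |k|} |k|^σ |û(k)|`, with values in
`[0, ∞]`. -/
def gevreyNorm {n : ℕ} (κ₀ lam σ : ℝ) (u : CoeffSeq n) : ENNReal :=
  ∑' k, ENNReal.ofReal
    (κ₀ ^ σ * (Real.exp (lam * κ₀ * waveAbs k) * waveAbs k ^ σ * ‖u k‖))

/-- The norm `‖u‖_σ = κ₀^σ ∑ₖ |k|^σ |û(k)|`, with values in `[0, ∞]`. -/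
def sobNorm {n : ℕ} (κ₀ σ : ℝ) (u : CoeffSeq n) : ENNReal :=
  ∑' k, ENNReal.ofReal (κ₀ ^ σ * (waveAbs k ^ σ * ‖u k‖))

/-- The dimensionless Wiener algebra norm `‖u‖_W = (ν κ₀)⁻¹ ∑ₖ |û(k)|`. -/
def wienerNorm {n : ℕ} (ν κ₀ : ℝ) (u : CoeffSeq n) : ENNReal :=
  ENNReal.ofReal ((ν * κ₀)⁻¹) * sobNorm κ₀ 0 u

/-- The space `V_σ`. -/
def sobSpace (n : ℕ) (κ₀ σ : ℝ) : Set (CoeffSeq n) :=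
  {u | u ∈ DivFree n ∧ sobNorm κ₀ σ u < ⊤}

/-- `u ∈ C([0, T]; V_σ)`, continuity being with respect to the norm of `V_σ`. -/
def ContinuousIntoSob {n : ℕ} (κ₀ σ T : ℝ) (u : ℝ → CoeffSeq n) : Prop :=
  (∀ t ∈ Set.Icc 0 T, u t ∈ sobSpace n κ₀ σ) ∧
  ∀ t₀ ∈ Set.Icc 0 T,
    Filter.Tendsto (fun t => sobNorm κ₀ σ (u t - u t₀)) (nhdsWithin t₀ (Set.Icc 0 T)) (nhds 0)

/-- The truncation `P_κ` to the modes `|k| ≤ κ / κ₀`. -/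
def truncModes {n : ℕ} (κ₀ κ : ℝ) (f : CoeffSeq n) : CoeffSeq n :=
  open Classical in fun k => if waveAbs k ≤ κ / κ₀ then f k else 0

/-- The periodic field `x ↦ ∑ₖ û(k) e^{i κ₀ k · x}`. -/
def field {n : ℕ} (κ₀ : ℝ) (u : CoeffSeq n) (x : Fin n → ℝ) : EuclideanSpace ℂ (Fin n) :=
  ∑' k : Fin n → ℤ,
    Complex.exp (Complex.I * (κ₀ : ℂ) * ∑ j, (k j : ℂ) * (x j : ℂ)) • u k

/-- The `L²` norm of the field with coefficients `u` over the periodic box `[0, L]ⁿ`,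
`L = 2π / κ₀`. -/
def l2Norm {n : ℕ} (κ₀ : ℝ) (u : CoeffSeq n) : ℝ :=
  Real.sqrt (∫ x in Set.Icc (0 : Fin n → ℝ) (fun _ => 2 * Real.pi / κ₀), ‖field κ₀ u x‖ ^ 2)

/-- The Grashof number `G = κ₀^{n/2} ‖f‖_{L²} / (ν² κ₀³)` of a time-independent force. -/
def grashof {n : ℕ} (ν κ₀ : ℝ) (f : CoeffSeq n) : ℝ :=
  κ₀ ^ ((n : ℝ) / 2) / (ν ^ 2 * κ₀ ^ 3) * l2Norm κ₀ f

/-- Weak solutions on `[0, T]` of the Navier-Stokes system with viscosity `ν`, time-independent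
(divergence-free) force `f` and initial value `u₀`. The equation for each Fourier mode holds for
almost every `t`; as usual this is understood for absolutely continuous modes, so that the
almost-everywhere derivative is the distributional one. -/
structure IsWeakSolution {n : ℕ} (ν κ₀ T : ℝ) (f u₀ : CoeffSeq n) (u : ℝ → CoeffSeq n) :
    Prop where
  mem : ∀ t ∈ Set.Icc 0 T, u t ∈ DivFree n
  cont : ContinuousOn u (Set.Icc 0 T)
  init : u 0 = u₀
  ac : ∀ k, AbsolutelyContinuousOnInterval (fun t => u t k) 0 T
  summable : ∀ k, ∀ᵐ t ∂(MeasureTheory.volume.restrict (Set.Icc 0 T)),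
    Summable (fun l : {l : Fin n → ℤ // l ≠ 0} => ‖bilinTerm (u t) (u t) k l‖)
  eqn : ∀ k, ∀ᵐ t ∂(MeasureTheory.volume.restrict (Set.Icc 0 T)),
    HasDerivAt (fun s => u s k)
      (-((ν * κ₀ ^ 2 * waveAbs k ^ 2 : ℝ) : ℂ) • u t k - bilin κ₀ (u t) (u t) k + f k) t

/-- Gevrey regularity on `[0, T]`: some norm `‖u(t)‖_{lam(t), σ}` is bounded on `[0, T]`, where
`lam : [0, ∞) → [0, ∞)` is increasing, sublinear, and positive for positive times (so that the
trivial choice `lam = 0` is not allowed). -/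
def GevreyRegular {n : ℕ} (κ₀ T : ℝ) (u : ℝ → CoeffSeq n) : Prop :=
  ∃ (σ : ℝ) (lam : NNReal → NNReal),
    Monotone lam ∧ (∀ s t, lam (s + t) ≤ lam s + lam t) ∧ (∀ t, 0 < t → 0 < lam t) ∧
    (⨆ t ∈ Set.Icc 0 T, gevreyNorm κ₀ (lam (Real.toNNReal t)) σ (u t)) < ⊤

/-- The maximal uniform radius of spatial analyticity
`sup {lam > 0 : ‖u‖_{lam, σ} < ∞}`, with values in `[0, ∞]`. -/
def analyticityRadius {n : ℕ} (κ₀ σ : ℝ) (u : CoeffSeq n) : ENNReal :=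
  sSup {r | ∃ lam : ℝ, 0 < lam ∧ gevreyNorm κ₀ lam σ u < ⊤ ∧ r = ENNReal.ofReal lam}

end

end NavierStokesTorus

/-!
The solution is a fixed point of the mild formulation in the space of weighted paths
`U(k, t) = e^{α κ₀ |k| t} û(k, t)` with norm `∑ₖ supₜ |U(k, t)|`. In this space the supremum in time
stands inside the sum over the modes, so that every estimate is made mode by mode. The weight passes
through the convolution because `|k| ≤ |ℓ| + |k - ℓ|` (`norm_bilin_sub_le`), and it is absorbed by half
of the dissipation as long as `α² T ≤ ν`; the remaining half absorbs the derivative in the nonlinear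
term at the cost of a factor `√(T / ν)`, uniformly in `k` (`mul_integral_exp_weight_le`). The mild
map is therefore a contraction on a ball of radius `R` once `√(T / ν) R` is small
(`exists_mild_solution`).

By hypothesis the initial value is at most a multiple of `ν κ₀ G^{1/2}`. The force has finitely many
modes, each of size at most `ν² κ₀³ G` by Parseval's identity (`norm_le_grashof`), and over a time
`T` comparable to `(ν κ₀² max(1, G))⁻¹` it contributes at most a multiple of `ν κ₀`. Hence `R` can be
taken comparable to `ν κ₀ max(1, G)^{1/2}`, and the smallness condition is met by
`ν κ₀² T = ε² / max(1, G)` with `ε` depending only on `n`, `κ₀`, `κ̄` and `C`. The choice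
`α = √(ν / T)` yields the radius of analyticity `α T = √(ν T) = ε κ₀⁻¹ max(1, G)^{-1/2}` at time `T`,
and Gevrey regularity with the linear rate `α t`.

For uniqueness no smallness is available, and the supremum in time cannot be taken inside the sum for
an arbitrary element of `C([0, T]; V₀)`. The difference of two solutions is instead measured in
`∑ₖ ∫ e^{-β t} |ŵ(k, t)| dt`: each mode satisfies a Duhamel inequality
(`enorm_le_lintegral_of_absolutelyContinuous`), and integrating its kernel in time gives the factor
`κ₀ |k| / (ν κ₀² |k|² + β)`, which is small for large `β` uniformly in `k`
(`eq_zero_of_duhamel_convolution`).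
-/

namespace NavierStokesTorus

/-! ### Wave vectors and the Leray symbol -/

lemma waveAbs_nonneg {n : ℕ} (k : Fin n → ℤ) : 0 ≤ waveAbs k := Real.sqrt_nonneg _

lemma norm_waveVec {n : ℕ} (k : Fin n → ℤ) : ‖waveVec k‖ = waveAbs k := by
  simp [waveVec, waveAbs, EuclideanSpace.norm_eq]

lemma waveVec_sub {n : ℕ} (k l : Fin n → ℤ) : waveVec (k - l) = waveVec k - waveVec l := by
  ext j; simp [waveVec]

lemma waveVec_neg {n : ℕ} (k : Fin n → ℤ) : waveVec (-k) = -waveVec k := by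
  ext j; simp [waveVec]

lemma waveAbs_neg {n : ℕ} (k : Fin n → ℤ) : waveAbs (-k) = waveAbs k := by
  rw [← norm_waveVec, waveVec_neg, norm_neg, norm_waveVec]

lemma waveAbs_le_add {n : ℕ} (k l : Fin n → ℤ) : waveAbs k ≤ waveAbs l + waveAbs (k - l) := by
  simp only [← norm_waveVec, waveVec_sub]
  exact norm_le_norm_add_norm_sub' (waveVec k) (waveVec l)

lemma waveAbs_eq_zero {n : ℕ} {k : Fin n → ℤ} : waveAbs k = 0 ↔ k = 0 := by
  rw [← norm_waveVec, norm_eq_zero]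
  constructor
  · intro h
    funext j
    simpa [waveVec] using congrArg (fun w : EuclideanSpace ℂ (Fin n) => w j) h
  · rintro rfl
    ext j
    simp [waveVec]

lemma waveDot_eq_inner {n : ℕ} (k : Fin n → ℤ) (w : EuclideanSpace ℂ (Fin n)) :
    waveDot k w = inner ℂ (waveVec k) w := by
  simp [waveDot, waveVec, PiLp.inner_apply, mul_comm]

lemma norm_waveDot_le {n : ℕ} (k : Fin n → ℤ) (w : EuclideanSpace ℂ (Fin n)) :
    ‖waveDot k w‖ ≤ waveAbs k * ‖w‖ := by
  rw [waveDot_eq_inner, ← norm_waveVec]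
  exact norm_inner_le_norm _ _

lemma waveDot_sub {n : ℕ} (k : Fin n → ℤ) (w z : EuclideanSpace ℂ (Fin n)) :
    waveDot k (w - z) = waveDot k w - waveDot k z := by
  simp only [waveDot_eq_inner, inner_sub_right]

lemma waveDot_smul {n : ℕ} (k : Fin n → ℤ) (c : ℂ) (w : EuclideanSpace ℂ (Fin n)) :
    waveDot k (c • w) = c * waveDot k w := by
  simp only [waveDot_eq_inner, inner_smul_right]

lemma waveDot_waveVec {n : ℕ} (k : Fin n → ℤ) :
    waveDot k (waveVec k) = (waveAbs k : ℂ) ^ 2 := by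
  rw [waveDot_eq_inner, inner_self_eq_norm_sq_to_K, norm_waveVec]
  rfl

/-- At `k = 0` both sides vanish, in spite of the division by `|k|²` in the symbol. -/
lemma waveDot_leray {n : ℕ} (k : Fin n → ℤ) (w : EuclideanSpace ℂ (Fin n)) :
    waveDot k (leray k w) = 0 := by
  by_cases hk : k = 0
  · subst hk; simp [waveDot]
  · have : (waveAbs k : ℂ) ^ 2 ≠ 0 := by
      simpa using (waveAbs_eq_zero.not.mpr hk)
    rw [leray, waveDot_sub, waveDot_smul, waveDot_waveVec, div_mul_cancel₀ _ this, sub_self]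

lemma leray_sub {n : ℕ} (k : Fin n → ℤ) (w z : EuclideanSpace ℂ (Fin n)) :
    leray k (w - z) = leray k w - leray k z := by
  simp only [leray, waveDot_sub, sub_div, sub_smul]
  abel

/-- The constant is `1` in truth, the symbol being an orthogonal projection; the crude bound by
the triangle inequality is enough. -/
lemma norm_leray_le {n : ℕ} (k : Fin n → ℤ) (w : EuclideanSpace ℂ (Fin n)) :
    ‖leray k w‖ ≤ 2 * ‖w‖ := by
  have h : ‖(waveDot k w / ((waveAbs k : ℂ) ^ 2)) • waveVec k‖ ≤ ‖w‖ := by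
    by_cases hk : waveAbs k = 0
    · simp [hk]
    · have hpos : 0 < waveAbs k := lt_of_le_of_ne (waveAbs_nonneg k) (Ne.symm hk)
      rw [norm_smul, norm_div, norm_pow, Complex.norm_real, norm_waveVec, Real.norm_eq_abs,
        abs_of_pos hpos, div_mul_eq_mul_div, div_le_iff₀ (by positivity)]
      nlinarith [norm_waveDot_le k w]
  calc ‖leray k w‖ ≤ ‖w‖ + ‖(waveDot k w / ((waveAbs k : ℂ) ^ 2)) • waveVec k‖ := norm_sub_le _ _
    _ ≤ 2 * ‖w‖ := by linarith

lemma continuous_waveDot {n : ℕ} (k : Fin n → ℤ) :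
    Continuous (waveDot k : EuclideanSpace ℂ (Fin n) → ℂ) := by
  unfold waveDot; fun_prop

lemma continuous_leray {n : ℕ} (k : Fin n → ℤ) :
    Continuous (leray k : EuclideanSpace ℂ (Fin n) → EuclideanSpace ℂ (Fin n)) := by
  have := continuous_waveDot k
  unfold leray; fun_prop

/-- Coordinatewise complex conjugation on `ℂⁿ`. -/
def conjVec {n : ℕ} (w : EuclideanSpace ℂ (Fin n)) : EuclideanSpace ℂ (Fin n) :=
  WithLp.toLp 2 (fun j => (starRingEnd ℂ) (w j))

lemma conjVec_apply {n : ℕ} (w : EuclideanSpace ℂ (Fin n)) (j : Fin n) :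
    conjVec w j = (starRingEnd ℂ) (w j) := rfl

lemma norm_conjVec {n : ℕ} (w : EuclideanSpace ℂ (Fin n)) : ‖conjVec w‖ = ‖w‖ := by
  simp [EuclideanSpace.norm_eq, conjVec_apply]

/-- Coordinatewise conjugation as a real-linear isometry, so that it passes through sums of series
and through integrals. -/
def conjIso (n : ℕ) : EuclideanSpace ℂ (Fin n) ≃ₗᵢ[ℝ] EuclideanSpace ℂ (Fin n) where
  toFun := conjVec
  invFun := conjVec
  left_inv w := by ext j; simp [conjVec_apply]
  right_inv w := by ext j; simp [conjVec_apply]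
  map_add' w z := by ext j; simp [conjVec_apply]
  map_smul' c w := by ext j; simp [conjVec_apply]
  norm_map' := norm_conjVec

lemma conjIso_apply {n : ℕ} (w : EuclideanSpace ℂ (Fin n)) (j : Fin n) :
    conjIso n w j = (starRingEnd ℂ) (w j) := rfl

lemma conjIso_smul {n : ℕ} (c : ℂ) (w : EuclideanSpace ℂ (Fin n)) :
    conjIso n (c • w) = (starRingEnd ℂ) c • conjIso n w := by
  ext j; simp [conjIso_apply]

lemma waveDot_neg_conj {n : ℕ} (k : Fin n → ℤ) (w : EuclideanSpace ℂ (Fin n)) :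
    waveDot (-k) (conjIso n w) = -(starRingEnd ℂ) (waveDot k w) := by
  simp [waveDot, conjIso_apply, Finset.sum_neg_distrib]

lemma leray_neg_conj {n : ℕ} (k : Fin n → ℤ) (w : EuclideanSpace ℂ (Fin n)) :
    leray (-k) (conjIso n w) = conjIso n (leray k w) := by
  have h : conjIso n (waveVec k) = waveVec k := by ext j; simp [conjIso_apply, waveVec]
  simp only [leray, map_sub, conjIso_smul, waveDot_neg_conj, waveAbs_neg, waveVec_neg, h]
  simp [neg_div]

/-! ### The bilinear term on absolutely summable sequences -/

lemma norm_bilinTerm_le {n : ℕ} (u v : CoeffSeq n) (k l : Fin n → ℤ) :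
    ‖bilinTerm u v k l‖ ≤ waveAbs k * (‖u l‖ * ‖v (k - l)‖) := by
  rw [bilinTerm, norm_smul, ← mul_assoc]
  gcongr
  exact norm_waveDot_le _ _

lemma summable_mul_comp_sub {G : Type*} [AddCommGroup G] {a b : G → ℝ} (ha : Summable a)
    (hb : Summable b) (ha0 : ∀ l, 0 ≤ a l) (hb0 : ∀ l, 0 ≤ b l) (k : G) :
    Summable fun l => a l * b (k - l) := by
  refine Summable.of_nonneg_of_le (fun l => mul_nonneg (ha0 l) (hb0 _)) (fun l => ?_)
    (ha.mul_right (∑' m, b m))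
  exact mul_le_mul_of_nonneg_left (hb.le_tsum _ fun m _ => hb0 m) (ha0 l)

lemma hasSum_convolution {G : Type*} [AddCommGroup G] {a b : G → ℝ} (ha : Summable a)
    (hb : Summable b) (ha0 : ∀ l, 0 ≤ a l) (hb0 : ∀ l, 0 ≤ b l) :
    HasSum (fun k => ∑' l, a l * b (k - l)) ((∑' l, a l) * ∑' l, b l) := by
  have hs : Summable fun p : G × G => a p.1 * b p.2 := ha.mul_of_nonneg hb ha0 hb0
  have hp : HasSum (fun p : G × G => a p.1 * b p.2) ((∑' l, a l) * ∑' l, b l) :=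
    ha.hasSum.mul hb.hasSum hs
  let e : G × G ≃ G × G :=
    { toFun := fun p => (p.2, p.1 - p.2)
      invFun := fun p => (p.1 + p.2, p.1)
      left_inv := fun p => by simp
      right_inv := fun p => by simp }
  have hq : HasSum (fun p : G × G => a p.2 * b (p.1 - p.2)) ((∑' l, a l) * ∑' l, b l) :=
    (e.hasSum_iff (f := fun p : G × G => a p.1 * b p.2)).mpr hp
  exact hq.prod_fiberwise fun k => (summable_mul_comp_sub ha hb ha0 hb0 k).hasSum

lemma summable_bilinTerm {n : ℕ} {u v : CoeffSeq n} (hu : Summable fun k => ‖u k‖)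
    (hv : Summable fun k => ‖v k‖) (k : Fin n → ℤ) :
    Summable fun l => ‖bilinTerm u v k l‖ :=
  Summable.of_nonneg_of_le (fun _ => norm_nonneg _) (fun l => norm_bilinTerm_le u v k l)
    ((summable_mul_comp_sub hu hv (fun _ => norm_nonneg _) (fun _ => norm_nonneg _) k).mul_left _)

lemma bilinTerm_sub {n : ℕ} (u v : CoeffSeq n) (k l : Fin n → ℤ) :
    bilinTerm u u k l - bilinTerm v v k l =
      bilinTerm (u - v) u k l + bilinTerm v (u - v) k l := by
  simp only [bilinTerm, Pi.sub_apply, waveDot_sub, sub_smul, smul_sub]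
  abel

/-- The quadratic estimate behind both existence and uniqueness: the exponential weight is carried
through the convolution by the triangle inequality `|k| ≤ |ℓ| + |k - ℓ|`, and the derivative costs
one factor `κ₀ |k|`. -/
lemma norm_bilin_sub_le {n : ℕ} {κ₀ ρ : ℝ} (hκ₀ : 0 ≤ κ₀) (hρ : 0 ≤ ρ) {u v : CoeffSeq n}
    {a b d : (Fin n → ℤ) → ℝ} (ha : Summable a) (hb : Summable b) (hd : Summable d)
    (hua : ∀ l, ‖u l‖ ≤ Real.exp (-(ρ * waveAbs l)) * a l)
    (hvb : ∀ l, ‖v l‖ ≤ Real.exp (-(ρ * waveAbs l)) * b l)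
    (hwd : ∀ l, ‖(u - v) l‖ ≤ Real.exp (-(ρ * waveAbs l)) * d l) (k : Fin n → ℤ) :
    ‖bilin κ₀ u u k - bilin κ₀ v v k‖ ≤
      2 * (κ₀ * waveAbs k) * (Real.exp (-(ρ * waveAbs k)) *
        ((∑' l, d l * a (k - l)) + ∑' l, b l * d (k - l))) := by
  have nn : ∀ {x : EuclideanSpace ℂ (Fin n)} {r s : ℝ}, ‖x‖ ≤ Real.exp r * s → 0 ≤ s := by
    intro x r s h
    exact nonneg_of_mul_nonneg_right ((norm_nonneg x).trans h) (Real.exp_pos r)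
  have ha0 : ∀ l, 0 ≤ a l := fun l => nn (hua l)
  have hb0 : ∀ l, 0 ≤ b l := fun l => nn (hvb l)
  have hd0 : ∀ l, 0 ≤ d l := fun l => nn (hwd l)
  have le1 : ∀ l : Fin n → ℤ, Real.exp (-(ρ * waveAbs l)) ≤ 1 := fun l => by
    rw [Real.exp_le_one_iff]; nlinarith [waveAbs_nonneg l]
  have hu : Summable fun l => ‖u l‖ := Summable.of_nonneg_of_le (fun _ => norm_nonneg _)
    (fun l => (hua l).trans (mul_le_of_le_one_left (ha0 l) (le1 l))) ha
  have hv : Summable fun l => ‖v l‖ := Summable.of_nonneg_of_le (fun _ => norm_nonneg _)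
    (fun l => (hvb l).trans (mul_le_of_le_one_left (hb0 l) (le1 l))) hb
  have hexp : ∀ l, Real.exp (-(ρ * waveAbs l)) * Real.exp (-(ρ * waveAbs (k - l))) ≤
      Real.exp (-(ρ * waveAbs k)) := fun l => by
    rw [← Real.exp_add, Real.exp_le_exp]
    nlinarith [waveAbs_le_add k l]
  have hprod : ∀ (x y : CoeffSeq n) (p q : (Fin n → ℤ) → ℝ), (∀ l, 0 ≤ p l) → (∀ l, 0 ≤ q l) →
      (∀ l, ‖x l‖ ≤ Real.exp (-(ρ * waveAbs l)) * p l) →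
      (∀ l, ‖y l‖ ≤ Real.exp (-(ρ * waveAbs l)) * q l) → ∀ l, ‖bilinTerm x y k l‖ ≤
        waveAbs k * Real.exp (-(ρ * waveAbs k)) * (p l * q (k - l)) := by
    intro x y p q hp hq hx hy l
    calc ‖bilinTerm x y k l‖ ≤ waveAbs k * (‖x l‖ * ‖y (k - l)‖) := norm_bilinTerm_le _ _ _ _
      _ ≤ waveAbs k * ((Real.exp (-(ρ * waveAbs l)) * p l) *
            (Real.exp (-(ρ * waveAbs (k - l))) * q (k - l))) := by
          gcongr
          · exact waveAbs_nonneg k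
          · exact (norm_nonneg _).trans (hx l)
          · exact hx l
          · exact hy _
      _ = waveAbs k * ((Real.exp (-(ρ * waveAbs l)) * Real.exp (-(ρ * waveAbs (k - l)))) *
            (p l * q (k - l))) := by ring
      _ ≤ waveAbs k * (Real.exp (-(ρ * waveAbs k)) * (p l * q (k - l))) := by
          gcongr
          · exact waveAbs_nonneg k
          · exact mul_nonneg (hp l) (hq _)
          · exact hexp l
      _ = _ := by ring
  have s1 := summable_mul_comp_sub hd ha hd0 ha0 k
  have s2 := summable_mul_comp_sub hb hd hb0 hd0 k
  have hsum : HasSum (fun l => waveAbs k * Real.exp (-(ρ * waveAbs k)) *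
      (d l * a (k - l) + b l * d (k - l))) (waveAbs k * Real.exp (-(ρ * waveAbs k)) *
        ((∑' l, d l * a (k - l)) + ∑' l, b l * d (k - l))) :=
    (s1.hasSum.add s2.hasSum).mul_left _
  have hterm : ∀ l, ‖bilinTerm u u k l - bilinTerm v v k l‖ ≤
      waveAbs k * Real.exp (-(ρ * waveAbs k)) * (d l * a (k - l) + b l * d (k - l)) := fun l => by
    rw [bilinTerm_sub, mul_add]
    exact (norm_add_le _ _).trans (add_le_add (hprod _ _ d a hd0 ha0 hwd hua l)
      (hprod _ _ b d hb0 hd0 hvb hwd l))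
  have hU : Summable fun l : {l : Fin n → ℤ // l ≠ 0} => bilinTerm u u k l :=
    (summable_bilinTerm hu hu k).of_norm.comp_injective Subtype.val_injective
  have hV : Summable fun l : {l : Fin n → ℤ // l ≠ 0} => bilinTerm v v k l :=
    (summable_bilinTerm hv hv k).of_norm.comp_injective Subtype.val_injective
  have hmain : ‖(∑' l : {l : Fin n → ℤ // l ≠ 0}, bilinTerm u u k l) -
      ∑' l : {l : Fin n → ℤ // l ≠ 0}, bilinTerm v v k l‖ ≤
      waveAbs k * Real.exp (-(ρ * waveAbs k)) *
        ((∑' l, d l * a (k - l)) + ∑' l, b l * d (k - l)) := by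
    rw [← hU.tsum_sub hV, ← hsum.tsum_eq]
    have hs' : Summable fun l : {l : Fin n → ℤ // l ≠ 0} =>
        waveAbs k * Real.exp (-(ρ * waveAbs k)) *
          (d l * a (k - l) + b l * d (k - l)) :=
      hsum.summable.comp_injective Subtype.val_injective
    refine (tsum_of_norm_bounded hs'.hasSum fun l => hterm l).trans ?_
    refine hs'.tsum_le_tsum_of_inj _ Subtype.val_injective (fun l _ => ?_) (fun l => le_rfl)
      hsum.summable
    exact (norm_nonneg _).trans (hterm l)
  rw [bilin, bilin, ← smul_sub, ← leray_sub, norm_smul, norm_mul, Complex.norm_I, one_mul,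
    Complex.norm_real, Real.norm_of_nonneg hκ₀]
  calc κ₀ * ‖leray k _‖ ≤ κ₀ * (2 * _) := by gcongr; exact norm_leray_le _ _
    _ ≤ κ₀ * (2 * (waveAbs k * Real.exp (-(ρ * waveAbs k)) *
        ((∑' l, d l * a (k - l)) + ∑' l, b l * d (k - l)))) := by gcongr
    _ = _ := by ring

lemma waveDot_bilin {n : ℕ} (κ₀ : ℝ) (u v : CoeffSeq n) (k : Fin n → ℤ) :
    waveDot k (bilin κ₀ u v k) = 0 := by
  rw [bilin, waveDot_smul, waveDot_leray, mul_zero]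

lemma bilin_zero_mode {n : ℕ} (κ₀ : ℝ) (u v : CoeffSeq n) : bilin κ₀ u v 0 = 0 := by
  simp [bilin, bilinTerm, waveDot, leray]

lemma bilin_zero {n : ℕ} (κ₀ : ℝ) (k : Fin n → ℤ) : bilin κ₀ (0 : CoeffSeq n) 0 k = 0 := by
  simp [bilin, bilinTerm, waveDot, leray]

/-- The bilinear term of a real field is a real field. -/
lemma bilin_neg_conj {n : ℕ} (κ₀ : ℝ) {u : CoeffSeq n} (hu : ∀ k, u (-k) = conjIso n (u k))
    (k : Fin n → ℤ) : bilin κ₀ u u (-k) = conjIso n (bilin κ₀ u u k) := by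
  have hterm : ∀ l, bilinTerm u u (-k) (-l) = -conjIso n (bilinTerm u u k l) := fun l => by
    have : -k - -l = -(k - l) := by abel
    rw [bilinTerm, bilinTerm, this, hu, hu, waveDot_neg_conj, conjIso_smul, neg_smul]
  let e : {l : Fin n → ℤ // l ≠ 0} ≃ {l : Fin n → ℤ // l ≠ 0} :=
    (Equiv.neg _).subtypeEquiv fun l => by simp
  have hsum : (∑' l : {l : Fin n → ℤ // l ≠ 0}, bilinTerm u u (-k) l) =
      -conjIso n (∑' l : {l : Fin n → ℤ // l ≠ 0}, bilinTerm u u k l) := by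
    rw [← e.tsum_eq]
    have := (conjIso n).toContinuousLinearEquiv.map_tsum
      (L := .unconditional _)
      (f := fun l : {l : Fin n → ℤ // l ≠ 0} => bilinTerm u u k l)
    rw [LinearIsometryEquiv.coe_toContinuousLinearEquiv] at this
    rw [this, ← tsum_neg]
    exact tsum_congr fun l => hterm l
  have hneg : ∀ w, leray (-k) (-w) = -leray (-k) w := fun w => by
    have h0 : leray (-k) (0 : EuclideanSpace ℂ (Fin n)) = 0 := by simp [leray, waveDot]
    rw [← zero_sub w, leray_sub, h0, zero_sub]
  rw [bilin, bilin, hsum, conjIso_smul, ← leray_neg_conj, hneg]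
  simp

/-! ### Duhamel's inequality for absolutely continuous functions -/

/-- An absolutely continuous `w` with `w 0 = 0` and `w' = -γ w + g` almost everywhere is dominated by
the Duhamel integral of `‖g‖`. The source `g` need not be measurable a priori: it is almost
everywhere a derivative. -/
lemma enorm_le_lintegral_of_absolutelyContinuous {F : Type*} [NormedAddCommGroup F]
    [NormedSpace ℝ F] [CompleteSpace F] {w g : ℝ → F} {T γ M : ℝ}
    (hT : 0 ≤ T) (hac : AbsolutelyContinuousOnInterval w 0 T) (h0 : w 0 = 0)
    (hder : ∀ᵐ t ∂(MeasureTheory.volume.restrict (Set.Icc 0 T)),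
      HasDerivAt w (-γ • w t + g t) t)
    (hM : ∀ t ∈ Set.Icc 0 T, ‖g t‖ ≤ M) {t : ℝ} (ht : t ∈ Set.Icc 0 T) :
    ‖w t‖ₑ ≤ ∫⁻ s in Set.Ioc 0 t, ENNReal.ofReal (Real.exp (-(γ * (t - s)))) * ‖g s‖ₑ := by
  have huIcc : Set.uIcc 0 T = Set.Icc 0 T := Set.uIcc_of_le hT
  set z : ℝ → F := fun s => Real.exp (γ * s) • w s with hz
  have hzac : AbsolutelyContinuousOnInterval z 0 T := by
    have he : AbsolutelyContinuousOnInterval (fun s => Real.exp (γ * s)) 0 T :=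
      ContDiffOn.absolutelyContinuousOnInterval (by fun_prop)
    exact he.smul hac
  rw [MeasureTheory.ae_restrict_iff' measurableSet_Icc] at hder
  have hzder : ∀ᵐ s, s ∈ Set.Icc 0 T → HasDerivAt z (Real.exp (γ * s) • g s) s := by
    filter_upwards [hder] with s hs hsI
    have he : HasDerivAt (fun s => Real.exp (γ * s)) (Real.exp (γ * s) * γ) s := by
      simpa using ((hasDerivAt_id s).const_mul γ).exp
    have := he.smul (hs hsI)
    convert! this using 1
    rw [smul_add, smul_smul, add_assoc, add_comm, add_assoc, ← add_smul]
    simp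
  obtain ⟨K, hK⟩ : ∃ K : NNReal, ∀ᵐ s, s ∈ Set.Icc 0 T → ‖deriv z s‖ ≤ K := by
    obtain ⟨K, hK⟩ := (isCompact_Icc (a := (0 : ℝ)) (b := T)).exists_bound_of_continuousOn
      (f := fun s => Real.exp (γ * s)) (by fun_prop)
    refine ⟨⟨|K| * |M|, by positivity⟩, ?_⟩
    filter_upwards [hzder] with s hs hsI
    rw [(hs hsI).deriv, norm_smul]
    exact mul_le_mul ((hK s hsI).trans (le_abs_self _)) ((hM s hsI).trans (le_abs_self _))
      (norm_nonneg _) (abs_nonneg _)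
  have hsub : ∀ {a b : ℝ}, a ∈ Set.Icc 0 T → b ∈ Set.Icc 0 T → Set.uIoc a b ⊆ Set.Icc 0 T :=
    fun ha hb => Set.uIoc_subset_uIcc.trans (Set.uIcc_subset_Icc ha hb)
  have hint : IntervalIntegrable (deriv z) MeasureTheory.volume 0 T := by
    rw [intervalIntegrable_iff]
    refine MeasureTheory.Measure.integrableOn_of_bounded (M := K) (by simp)
      (aestronglyMeasurable_deriv z _) ?_
    rw [MeasureTheory.ae_restrict_iff' measurableSet_uIoc]
    filter_upwards [hK] with s hs hsI
    exact hs (hsub ⟨le_rfl, hT⟩ ⟨hT, le_rfl⟩ hsI)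
  have hint' : ∀ {a b : ℝ}, a ∈ Set.Icc 0 T → b ∈ Set.Icc 0 T →
      IntervalIntegrable (deriv z) MeasureTheory.volume a b := fun ha hb =>
    hint.mono_set (by rw [huIcc]; exact Set.uIcc_subset_Icc ha hb)
  set Y : ℝ → F := fun s => ∫ r in (0 : ℝ)..s, deriv z r with hY
  have hYac : AbsolutelyContinuousOnInterval Y 0 T := by
    refine LipschitzOnWith.absolutelyContinuousOnInterval (K := K) ?_
    rw [huIcc]
    refine LipschitzOnWith.of_dist_le_mul fun a ha b hb => ?_
    have hz0 : (0 : ℝ) ∈ Set.Icc 0 T := ⟨le_rfl, hT⟩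
    rw [dist_eq_norm, hY, intervalIntegral.integral_interval_sub_left (hint' hz0 ha) (hint' hz0 hb),
      Real.dist_eq]
    refine intervalIntegral.norm_integral_le_of_norm_le_const_ae ?_
    filter_upwards [hK] with s hs hsI
    exact hs (hsub hb ha hsI)
  have hconst : ∃ C, ∀ x ∈ Set.uIcc 0 T, (z - Y) x = C := by
    refine (hzac.sub hYac).const_of_ae_hasDerivAt_zero ?_
    filter_upwards [hzder, hint.ae_hasDerivAt_integral] with s h1 h2 hs
    have hs' : s ∈ Set.Icc 0 T := huIcc ▸ hs
    have h3 := h2 hs 0 (by simp)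
    rw [(h1 hs').deriv] at h3
    simpa using (h1 hs').sub h3
  obtain ⟨C, hC⟩ := hconst
  have hC0 : C = 0 := by
    rw [← hC 0 (by simp)]
    simp [hz, hY, h0]
  have hzY : z t = Y t := by
    have := hC t (by rwa [huIcc])
    rw [hC0, Pi.sub_apply] at this
    exact sub_eq_zero.mp this
  have hw : w t = Real.exp (-(γ * t)) • Y t := by
    rw [← hzY, hz, smul_smul, ← Real.exp_add]
    simp
  have hYt : ‖Y t‖ₑ ≤ ∫⁻ s in Set.Ioc 0 t, ENNReal.ofReal (Real.exp (γ * s)) * ‖g s‖ₑ := by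
    rw [hY]
    simp only
    rw [intervalIntegral.integral_of_le ht.1]
    refine (MeasureTheory.enorm_integral_le_lintegral_enorm _).trans (le_of_eq ?_)
    refine MeasureTheory.setLIntegral_congr_fun_ae measurableSet_Ioc ?_
    filter_upwards [hzder] with s hs hsI
    rw [(hs ⟨hsI.1.le, hsI.2.trans ht.2⟩).deriv, enorm_smul, Real.enorm_eq_ofReal (Real.exp_pos _).le]
  calc ‖w t‖ₑ = ENNReal.ofReal (Real.exp (-(γ * t))) * ‖Y t‖ₑ := by
        rw [hw, enorm_smul, Real.enorm_eq_ofReal (Real.exp_pos _).le]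
    _ ≤ ENNReal.ofReal (Real.exp (-(γ * t))) *
        ∫⁻ s in Set.Ioc 0 t, ENNReal.ofReal (Real.exp (γ * s)) * ‖g s‖ₑ := by gcongr
    _ = _ := by
        rw [← MeasureTheory.lintegral_const_mul' _ _ ENNReal.ofReal_ne_top]
        congr 1
        funext s
        rw [← mul_assoc, ← ENNReal.ofReal_mul (Real.exp_pos _).le, ← Real.exp_add]
        congr 3
        ring

/-! ### Uniqueness -/

lemma lintegral_exp_neg_le {a : ℝ} (ha : 0 < a) (s : ℝ) :
    ∫⁻ t in Set.Ioi s, ENNReal.ofReal (Real.exp (-(a * (t - s)))) ≤ ENNReal.ofReal a⁻¹ := by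
  have h : ∀ t, Real.exp (-(a * (t - s))) = Real.exp (a * s) * Real.exp (-a * t) := fun t => by
    rw [← Real.exp_add]; ring_nf
  have hi := integrableOn_exp_mul_Ioi (neg_lt_zero.mpr ha) s
  rw [← MeasureTheory.ofReal_integral_eq_lintegral_ofReal]
  · simp_rw [h]
    rw [MeasureTheory.integral_const_mul, integral_exp_mul_Ioi (neg_lt_zero.mpr ha)]
    apply ENNReal.ofReal_le_ofReal
    rw [neg_div_neg_eq, ← mul_div_assoc, ← Real.exp_add]
    simp
  · simp_rw [h]
    exact hi.const_mul _
  · exact Filter.Eventually.of_forall fun t => (Real.exp_pos _).le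

/-- A family of Duhamel inequalities whose kernels satisfy `x² ≤ A γ` forces the family to vanish.
With the weight `e^{-β t}` the total mass `∑ₖ ∫ e^{-β t} ωₖ(t) dt` is at most
`M supₖ xₖ / (γₖ + β)` times itself, and this factor is at most `1 / 2` for large `β`. -/
lemma eq_zero_of_duhamel_convolution {G : Type*} [AddCommGroup G] [Countable G]
    {ω p : G → ℝ → ENNReal} {x γ : G → ℝ} {A M T : ℝ} (hA : 0 < A) (hM : 0 ≤ M)
    (hω : ∀ k, Measurable (ω k)) (hp : ∀ k, Measurable (p k))
    (hγ : ∀ k, 0 ≤ γ k) (hxγ : ∀ k, x k ^ 2 ≤ A * γ k)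
    (hωM : ∀ t ∈ Set.Icc 0 T, ∑' k, ω k t ≤ ENNReal.ofReal M)
    (hpM : ∀ t ∈ Set.Icc 0 T, ∑' k, p k t ≤ ENNReal.ofReal M)
    (hduh : ∀ k, ∀ t ∈ Set.Icc 0 T, ω k t ≤ ∫⁻ s in Set.Ioc 0 t,
      ENNReal.ofReal (Real.exp (-(γ k * (t - s)))) *
        (ENNReal.ofReal (x k) * ∑' l, ω l s * p (k - l) s)) :
    ∀ k, ∀ t ∈ Set.Icc 0 T, ω k t = 0 := by
  -- `θ` makes the contraction factor `θ M` at most `1 / 2`, and `β` makes `x ≤ θ (γ + β)`.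
  set θ : ℝ := 1 / (2 * (M + 1)) with hθ
  have hθ0 : 0 < θ := by positivity
  set β : ℝ := A / (4 * θ ^ 2) with hβ
  have hβ0 : 0 < β := by positivity
  have hxθ : ∀ k, x k ≤ θ * (γ k + β) := fun k => by
    have h1 : 4 * θ ^ 2 * β = A := by rw [hβ]; field_simp
    have h2 : 0 ≤ θ * (γ k + β) := mul_nonneg hθ0.le (add_nonneg (hγ k) hβ0.le)
    refine le_of_sq_le_sq ?_ h2
    nlinarith [hxγ k, mul_nonneg (sq_nonneg θ) (sq_nonneg (γ k - β))]
  set F : G → ℝ → ENNReal := fun k s => ∑' l, ω l s * p (k - l) s with hF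
  have hFm : ∀ k, Measurable (F k) := fun k =>
    Measurable.tsum fun l => (hω l).mul (hp _)
  set μ : MeasureTheory.Measure ℝ := MeasureTheory.volume.restrict (Set.Ioc 0 T) with hμ
  set e : ℝ → ENNReal := fun t => ENNReal.ofReal (Real.exp (-(β * t))) with he
  have hem : Measurable e := by fun_prop
  have heω : ∀ k, Measurable fun t => e t * ω k t := fun k => hem.mul (hω k)
  have heF : ∀ k, Measurable fun t => e t * F k t := fun k => hem.mul (hFm k)
  set I : ENNReal := ∑' k, ∫⁻ t, e t * ω k t ∂μ with hI
  have hIfin : I ≠ ⊤ := by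
    rw [hI, ← MeasureTheory.lintegral_tsum fun k => (heω k).aemeasurable]
    refine ne_top_of_le_ne_top (b := ENNReal.ofReal M * ENNReal.ofReal T)
      (ENNReal.mul_ne_top ENNReal.ofReal_ne_top ENNReal.ofReal_ne_top) ?_
    calc ∫⁻ t, ∑' k, e t * ω k t ∂μ ≤ ∫⁻ _, ENNReal.ofReal M ∂μ := by
          refine MeasureTheory.setLIntegral_mono measurable_const fun t ht => ?_
          rw [ENNReal.tsum_mul_left]
          refine (mul_le_of_le_one_left' ?_).trans (hωM t ⟨ht.1.le, ht.2⟩)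
          rw [he, ENNReal.ofReal_le_one, Real.exp_le_one_iff]
          nlinarith [ht.1]
      _ = ENNReal.ofReal M * ENNReal.ofReal T := by simp [hμ]
  -- One mode: exchange the two time integrals and integrate the kernel in the later time.
  have hmode : ∀ k, ∫⁻ t, e t * ω k t ∂μ ≤ ENNReal.ofReal θ * ∫⁻ s, e s * F k s ∂μ := by
    intro k
    have hγβ : 0 < γ k + β := add_pos_of_nonneg_of_pos (hγ k) hβ0
    set N : ℝ → ℝ → ENNReal := fun t s => Set.indicator (Set.Ioi s)
      (fun t => ENNReal.ofReal (Real.exp (-((γ k + β) * (t - s))))) t with hN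
    have hNm : Measurable (Function.uncurry N) := by
      have : Function.uncurry N = Set.indicator {q : ℝ × ℝ | q.2 < q.1}
          (fun q => ENNReal.ofReal (Real.exp (-((γ k + β) * (q.1 - q.2))))) := by
        funext q
        simp only [hN, Function.uncurry, Set.indicator, Set.mem_Ioi, Set.mem_ofPred_eq]
      rw [this]
      exact Measurable.indicator (by fun_prop) (measurableSet_lt measurable_snd measurable_fst)
    have hpt : ∀ t ∈ Set.Ioc 0 T, e t * ω k t ≤
        ∫⁻ s, N t s * (ENNReal.ofReal (x k) * (e s * F k s)) ∂μ := by
      intro t ht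
      calc e t * ω k t ≤ e t * ∫⁻ s in Set.Ioc 0 t, ENNReal.ofReal (Real.exp (-(γ k * (t - s)))) *
            (ENNReal.ofReal (x k) * F k s) := by gcongr; exact hduh k t ⟨ht.1.le, ht.2⟩
        _ = ∫⁻ s in Set.Ioo 0 t, N t s * (ENNReal.ofReal (x k) * (e s * F k s)) := by
            rw [← MeasureTheory.lintegral_const_mul' _ _ ENNReal.ofReal_ne_top,
              MeasureTheory.setLIntegral_congr MeasureTheory.Ioo_ae_eq_Ioc.symm]
            refine MeasureTheory.setLIntegral_congr_fun measurableSet_Ioo fun s hs => ?_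
            have hst : t ∈ Set.Ioi s := hs.2
            have hexp : e t * ENNReal.ofReal (Real.exp (-(γ k * (t - s)))) =
                ENNReal.ofReal (Real.exp (-((γ k + β) * (t - s)))) * e s := by
              simp only [he]
              rw [← ENNReal.ofReal_mul (Real.exp_pos _).le, ← ENNReal.ofReal_mul (Real.exp_pos _).le,
                ← Real.exp_add, ← Real.exp_add]
              ring_nf
            simp only [hN, Set.indicator_of_mem hst]
            rw [← mul_assoc, hexp]
            ring
        _ ≤ _ := by
            refine MeasureTheory.lintegral_mono_set fun s hs => ⟨hs.1, hs.2.le.trans ht.2⟩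
    calc ∫⁻ t, e t * ω k t ∂μ
        ≤ ∫⁻ t, ∫⁻ s, N t s * (ENNReal.ofReal (x k) * (e s * F k s)) ∂μ ∂μ :=
          MeasureTheory.setLIntegral_mono' measurableSet_Ioc hpt
      _ = ∫⁻ s, ∫⁻ t, N t s * (ENNReal.ofReal (x k) * (e s * F k s)) ∂μ ∂μ := by
          refine MeasureTheory.lintegral_lintegral_swap (Measurable.aemeasurable ?_)
          exact hNm.mul (((heF k).const_mul _).comp measurable_snd)
      _ ≤ ∫⁻ s, ENNReal.ofReal θ * (e s * F k s) ∂μ := by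
          refine MeasureTheory.lintegral_mono fun s => ?_
          have hNs : Measurable fun t => N t s := hNm.comp (measurable_id.prodMk measurable_const)
          rw [MeasureTheory.lintegral_mul_const _ hNs, ← mul_assoc]
          gcongr
          calc (∫⁻ t, N t s ∂μ) * ENNReal.ofReal (x k)
              ≤ ENNReal.ofReal (γ k + β)⁻¹ * ENNReal.ofReal (x k) := by
                gcongr
                refine (MeasureTheory.lintegral_mono' MeasureTheory.Measure.restrict_le_self
                  le_rfl).trans ?_
                simp only [hN]
                rw [MeasureTheory.lintegral_indicator measurableSet_Ioi]
                exact lintegral_exp_neg_le hγβ s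
            _ ≤ ENNReal.ofReal θ := by
                rw [← ENNReal.ofReal_mul (by positivity)]
                apply ENNReal.ofReal_le_ofReal
                rw [inv_mul_le_iff₀ hγβ, mul_comm]
                exact hxθ k
      _ = _ := MeasureTheory.lintegral_const_mul _ (heF k)
  have hsumF : ∀ s ∈ Set.Icc 0 T, ∑' k, F k s ≤ ENNReal.ofReal M * ∑' l, ω l s := by
    intro s hs
    calc ∑' k, ∑' l, ω l s * p (k - l) s = ∑' l, ω l s * ∑' k, p (k - l) s := by
          rw [ENNReal.tsum_comm]
          exact tsum_congr fun l => ENNReal.tsum_mul_left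
      _ ≤ ∑' l, ω l s * ENNReal.ofReal M := by
          refine ENNReal.tsum_le_tsum fun l => ?_
          gcongr
          exact ((Equiv.subRight l).tsum_eq fun k => p k s).le.trans (hpM s hs)
      _ = _ := by rw [ENNReal.tsum_mul_right, mul_comm]
  have hI2 : I ≤ ENNReal.ofReal (1 / 2) * I := by
    calc I ≤ ∑' k, ENNReal.ofReal θ * ∫⁻ s, e s * F k s ∂μ := ENNReal.tsum_le_tsum hmode
      _ = ENNReal.ofReal θ * ∫⁻ s, e s * ∑' k, F k s ∂μ := by
          rw [ENNReal.tsum_mul_left,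
            ← MeasureTheory.lintegral_tsum fun k => (heF k).aemeasurable]
          simp_rw [ENNReal.tsum_mul_left]
      _ ≤ ENNReal.ofReal θ * ∫⁻ s, e s * (ENNReal.ofReal M * ∑' l, ω l s) ∂μ := by
          refine mul_le_mul_right ?_ _
          refine MeasureTheory.setLIntegral_mono' measurableSet_Ioc fun s hs => ?_
          gcongr
          exact hsumF s ⟨hs.1.le, hs.2⟩
      _ = ENNReal.ofReal θ * (ENNReal.ofReal M * I) := by
          congr 1
          rw [hI, ← MeasureTheory.lintegral_tsum fun k => (heω k).aemeasurable,
            ← MeasureTheory.lintegral_const_mul' _ _ ENNReal.ofReal_ne_top]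
          simp_rw [ENNReal.tsum_mul_left]
          congr 1
          funext s
          ring
      _ ≤ ENNReal.ofReal (1 / 2) * I := by
          rw [← mul_assoc, ← ENNReal.ofReal_mul hθ0.le]
          gcongr
          rw [hθ, div_mul_eq_mul_div, div_le_div_iff₀ (by positivity) (by norm_num)]
          linarith
  have hI0 : I = 0 := by
    by_contra hne
    have hlt : ENNReal.ofReal (1 / 2) * I < 1 * I := by
      refine (ENNReal.mul_lt_mul_iff_left hne hIfin).mpr ?_
      rw [ENNReal.ofReal_lt_one]; norm_num
    rw [one_mul] at hlt
    exact absurd hI2 (not_le.mpr hlt)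
  have hae : ∀ᵐ s ∂μ, ∀ k, ω k s = 0 := by
    rw [MeasureTheory.ae_all_iff]
    intro k
    have h0 : ∫⁻ t, e t * ω k t ∂μ = 0 := (ENNReal.tsum_eq_zero.mp hI0) k
    rw [MeasureTheory.lintegral_eq_zero_iff (heω k)] at h0
    filter_upwards [h0] with s hs
    have hes : e s ≠ 0 := by simp [he, Real.exp_pos]
    exact (mul_eq_zero.mp hs).resolve_left hes
  intro k t ht
  refine le_antisymm ((hduh k t ht).trans (le_of_eq ?_)) (by simp)
  refine MeasureTheory.lintegral_eq_zero_of_ae_eq_zero ?_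
  have hae' : ∀ᵐ s ∂(MeasureTheory.volume.restrict (Set.Ioc 0 t)), ∀ k, ω k s = 0 :=
    MeasureTheory.ae_mono (MeasureTheory.Measure.restrict_mono_set _
      (Set.Ioc_subset_Ioc_right ht.2)) hae
  filter_upwards [hae'] with s hs
  simp [hs]

lemma sobNorm_zero {n : ℕ} (κ₀ : ℝ) (u : CoeffSeq n) : sobNorm κ₀ 0 u = ∑' k, ‖u k‖ₑ := by
  simp [sobNorm, ofReal_norm]

lemma summable_norm_of_tsum_enorm_ne_top {ι F : Type*} [NormedAddCommGroup F] {u : ι → F}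
    (h : ∑' k, ‖u k‖ₑ ≠ ⊤) : Summable fun k => ‖u k‖ := by
  simpa using ENNReal.summable_toReal h

lemma tsum_enorm_eq_ofReal {ι F : Type*} [NormedAddCommGroup F] {u : ι → F}
    (h : Summable fun k => ‖u k‖) : ∑' k, ‖u k‖ₑ = ENNReal.ofReal (∑' k, ‖u k‖) := by
  rw [ENNReal.ofReal_tsum_of_nonneg (fun _ => norm_nonneg _) h]
  simp [ofReal_norm]

lemma ContinuousIntoSob.exists_bound {n : ℕ} {κ₀ T : ℝ} {u : ℝ → CoeffSeq n}
    (hu : ContinuousIntoSob κ₀ 0 T u) :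
    ∃ M : ℝ, 0 ≤ M ∧ ∀ t ∈ Set.Icc 0 T, ∑' k, ‖u t k‖ₑ ≤ ENNReal.ofReal M := by
  suffices h : ∃ M : ENNReal, M ≠ ⊤ ∧ ∀ t ∈ Set.Icc 0 T, ∑' k, ‖u t k‖ₑ ≤ M by
    obtain ⟨M, hM, h⟩ := h
    exact ⟨M.toReal, ENNReal.toReal_nonneg, by rwa [ENNReal.ofReal_toReal hM]⟩
  refine (isCompact_Icc (a := (0 : ℝ)) (b := T)).induction_on
    (p := fun s => ∃ M : ENNReal, M ≠ ⊤ ∧ ∀ t ∈ s, ∑' k, ‖u t k‖ₑ ≤ M) ?_ ?_ ?_ ?_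
  · exact ⟨0, by simp, by simp⟩
  · rintro s t hst ⟨M, hM, h⟩
    exact ⟨M, hM, fun r hr => h r (hst hr)⟩
  · rintro s t ⟨M, hM, h⟩ ⟨N, hN, h'⟩
    refine ⟨max M N, (max_lt hM.lt_top hN.lt_top).ne, fun r hr => ?_⟩
    rcases hr with hr | hr
    · exact (h r hr).trans (le_max_left _ _)
    · exact (h' r hr).trans (le_max_right _ _)
  · intro t₀ ht₀
    have h1 := (hu.2 t₀ ht₀).eventually (ge_mem_nhds (zero_lt_one (α := ENNReal)))
    have h2 : ∑' k, ‖u t₀ k‖ₑ ≠ ⊤ := by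
      rw [← sobNorm_zero κ₀]; exact (hu.1 t₀ ht₀).2.ne
    refine ⟨_, h1, 1 + ∑' k, ‖u t₀ k‖ₑ, ENNReal.add_ne_top.mpr ⟨by simp, h2⟩, fun t ht => ?_⟩
    have ht' : sobNorm κ₀ 0 (u t - u t₀) ≤ 1 := ht
    rw [sobNorm_zero] at ht'
    refine le_trans ?_ (add_le_add ht' le_rfl)
    rw [← ENNReal.tsum_add]
    refine ENNReal.tsum_le_tsum fun k => ?_
    calc ‖u t k‖ₑ = ‖(u t - u t₀) k + u t₀ k‖ₑ := by simp
      _ ≤ _ := enorm_add_le _ _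

/-- Projection of the time axis onto `[0, T]`, used to turn paths on `[0, T]` into paths on `ℝ`. -/
def clampTime (T t : ℝ) : ℝ := max 0 (min t T)

lemma continuous_clampTime (T : ℝ) : Continuous (clampTime T) := by
  unfold clampTime; fun_prop

lemma clampTime_mem {T : ℝ} (hT : 0 ≤ T) (t : ℝ) : clampTime T t ∈ Set.Icc 0 T :=
  ⟨le_max_left _ _, max_le hT (min_le_right _ _)⟩

lemma clampTime_of_mem {T t : ℝ} (ht : t ∈ Set.Icc 0 T) : clampTime T t = t := by
  rw [clampTime, min_eq_left ht.2, max_eq_right ht.1]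

/-- The unweighted case of the quadratic estimate, as an inequality in `[0, ∞]`. -/
lemma enorm_bilin_sub_le {n : ℕ} {κ₀ : ℝ} (hκ₀ : 0 ≤ κ₀) {u v : CoeffSeq n}
    (hu : Summable fun k => ‖u k‖) (hv : Summable fun k => ‖v k‖) (k : Fin n → ℤ) :
    ‖bilin κ₀ u u k - bilin κ₀ v v k‖ₑ ≤ ENNReal.ofReal (2 * (κ₀ * waveAbs k)) *
      ∑' l, ‖u l - v l‖ₑ * (‖u (k - l)‖ₑ + ‖v (k - l)‖ₑ) := by
  have hw : Summable fun k => ‖(u - v) k‖ :=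
    Summable.of_nonneg_of_le (fun _ => norm_nonneg _) (fun k => norm_sub_le _ _) (hu.add hv)
  have h := norm_bilin_sub_le hκ₀ (ρ := 0) le_rfl (u := u) (v := v) hu hv hw (by simp) (by simp) (by simp) k
  have hcomm : ∑' l, ‖v l‖ * ‖(u - v) (k - l)‖ = ∑' l, ‖(u - v) l‖ * ‖v (k - l)‖ := by
    rw [← (Equiv.subLeft k).tsum_eq]
    refine tsum_congr fun l => ?_
    simp [mul_comm]
  have s1 := summable_mul_comp_sub hw hu (fun _ => norm_nonneg _) (fun _ => norm_nonneg _) k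
  have s2 := summable_mul_comp_sub hw hv (fun _ => norm_nonneg _) (fun _ => norm_nonneg _) k
  rw [hcomm, ← s1.tsum_add s2] at h
  simp only [zero_mul, neg_zero, Real.exp_zero, one_mul, ← mul_add] at h
  have s3 : Summable fun l => ‖(u - v) l‖ * (‖u (k - l)‖ + ‖v (k - l)‖) := by
    simpa only [mul_add] using s1.add s2
  rw [← ofReal_norm]
  refine (ENNReal.ofReal_le_ofReal h).trans (le_of_eq ?_)
  rw [ENNReal.ofReal_mul (by have := waveAbs_nonneg k; positivity),
    ENNReal.ofReal_tsum_of_nonneg (fun l => by positivity) s3]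
  congr 1
  refine tsum_congr fun l => ?_
  rw [ENNReal.ofReal_mul (norm_nonneg _), ENNReal.ofReal_add (norm_nonneg _) (norm_nonneg _)]
  simp [ofReal_norm]

/-- Two weak solutions in `C([0, T]; V₀)` with the same data agree on `[0, T]`. -/
theorem IsWeakSolution.unique {n : ℕ} {ν κ₀ T : ℝ} (hν : 0 < ν) (hκ₀ : 0 < κ₀) (hT : 0 ≤ T)
    {f u₀ : CoeffSeq n} {u v : ℝ → CoeffSeq n} (hu : IsWeakSolution ν κ₀ T f u₀ u)
    (hv : IsWeakSolution ν κ₀ T f u₀ v) (hu' : ContinuousIntoSob κ₀ 0 T u)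
    (hv' : ContinuousIntoSob κ₀ 0 T v) : ∀ t ∈ Set.Icc 0 T, u t = v t := by
  obtain ⟨A, hA0, hA⟩ := hu'.exists_bound
  obtain ⟨B, hB0, hB⟩ := hv'.exists_bound
  have hcl : ∀ {t}, t ∈ Set.Icc 0 T → clampTime T t = t := fun ht => clampTime_of_mem ht
  have hcu : ∀ k, Continuous fun t => u (clampTime T t) k := fun k =>
    ((continuous_apply k).comp_continuousOn hu.cont).comp_continuous (continuous_clampTime T)
      (clampTime_mem hT)
  have hcv : ∀ k, Continuous fun t => v (clampTime T t) k := fun k =>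
    ((continuous_apply k).comp_continuousOn hv.cont).comp_continuous (continuous_clampTime T)
      (clampTime_mem hT)
  have hω : ∀ t ∈ Set.Icc 0 T, ∑' k, ‖u t k - v t k‖ₑ ≤ ENNReal.ofReal (A + B) := fun t ht => by
    rw [ENNReal.ofReal_add hA0 hB0]
    refine le_trans ?_ (add_le_add (hA t ht) (hB t ht))
    rw [← ENNReal.tsum_add]
    exact ENNReal.tsum_le_tsum fun k => enorm_sub_le
  have hp : ∀ t ∈ Set.Icc 0 T, ∑' k, (‖u t k‖ₑ + ‖v t k‖ₑ) ≤ ENNReal.ofReal (A + B) :=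
    fun t ht => by
      rw [ENNReal.ofReal_add hA0 hB0, ENNReal.tsum_add]
      exact add_le_add (hA t ht) (hB t ht)
  have hsum : ∀ {w : ℝ → CoeffSeq n} {D : ℝ} {t : ℝ}, ∑' k, ‖w t k‖ₑ ≤ ENNReal.ofReal D →
      Summable fun k => ‖w t k‖ := fun h =>
    summable_norm_of_tsum_enorm_ne_top (ne_top_of_le_ne_top ENNReal.ofReal_ne_top h)
  have hnl : ∀ k, ∀ t ∈ Set.Icc 0 T,
      ‖-(bilin κ₀ (u t) (u t) k - bilin κ₀ (v t) (v t) k)‖ₑ ≤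
        ENNReal.ofReal (2 * (κ₀ * waveAbs k)) *
          ∑' l, ‖u t l - v t l‖ₑ * (‖u t (k - l)‖ₑ + ‖v t (k - l)‖ₑ) := fun k t ht => by
    rw [enorm_neg]
    exact enorm_bilin_sub_le hκ₀.le (hsum (hA t ht)) (hsum (hB t ht)) k
  have hzero := eq_zero_of_duhamel_convolution
    (ω := fun k t => ‖u (clampTime T t) k - v (clampTime T t) k‖ₑ)
    (p := fun k t => ‖u (clampTime T t) k‖ₑ + ‖v (clampTime T t) k‖ₑ)
    (x := fun k => 2 * (κ₀ * waveAbs k)) (γ := fun k => ν * κ₀ ^ 2 * waveAbs k ^ 2)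
    (A := 4 / ν) (M := A + B) (T := T) (by positivity) (by positivity)
    (fun k => ((hcu k).sub (hcv k)).enorm.measurable)
    (fun k => (hcu k).enorm.measurable.add (hcv k).enorm.measurable)
    (fun k => by positivity) (fun k => le_of_eq (by field_simp; ring))
    (fun t ht => by simpa only [hcl ht] using hω t ht)
    (fun t ht => by simpa only [hcl ht] using hp t ht) ?_
  · intro t ht
    funext k
    have := hzero k t ht
    simp only [hcl ht, enorm_eq_zero] at this
    exact sub_eq_zero.mp this
  intro k t ht
  simp only [hcl ht]
  have hac := (hu.ac k).sub (hv.ac k)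
  have hder : ∀ᵐ t ∂(MeasureTheory.volume.restrict (Set.Icc 0 T)),
      HasDerivAt ((fun t => u t k) - fun t => v t k)
        (-(ν * κ₀ ^ 2 * waveAbs k ^ 2) • ((fun t => u t k) - fun t => v t k) t +
          -(bilin κ₀ (u t) (u t) k - bilin κ₀ (v t) (v t) k)) t := by
    filter_upwards [hu.eqn k, hv.eqn k] with t h1 h2
    convert! h1.sub h2 using 1
    have : ∀ (r : ℝ) (w : EuclideanSpace ℂ (Fin n)), -(r : ℂ) • w = -(r • w) := fun r w => by
      ext j; simp
    simp only [Pi.sub_apply, this, neg_smul, smul_sub]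
    abel
  have hb : ∀ t ∈ Set.Icc 0 T, ‖-(bilin κ₀ (u t) (u t) k - bilin κ₀ (v t) (v t) k)‖ ≤
      2 * (κ₀ * waveAbs k) * ((A + B) * (A + B)) := fun t ht => by
    have hpos : 0 ≤ 2 * (κ₀ * waveAbs k) := by have := waveAbs_nonneg k; positivity
    rw [← ENNReal.ofReal_le_ofReal_iff (by positivity), ofReal_norm]
    refine (hnl k t ht).trans ?_
    rw [ENNReal.ofReal_mul hpos, ENNReal.ofReal_mul (add_nonneg hA0 hB0)]
    gcongr
    calc ∑' l, ‖u t l - v t l‖ₑ * (‖u t (k - l)‖ₑ + ‖v t (k - l)‖ₑ)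
        ≤ ∑' l, ‖u t l - v t l‖ₑ * ENNReal.ofReal (A + B) := by
          refine ENNReal.tsum_le_tsum fun l => ?_
          gcongr
          exact (ENNReal.le_tsum (k - l)).trans (hp t ht)
      _ ≤ _ := by
          rw [ENNReal.tsum_mul_right]
          exact mul_le_mul_left (hω t ht) _
  refine (enorm_le_lintegral_of_absolutelyContinuous hT hac (by simp [hu.init, hv.init]) hder hb
    ht).trans ?_
  refine MeasureTheory.setLIntegral_mono' measurableSet_Ioc fun s hs => ?_
  have hs' : s ∈ Set.Icc 0 T := ⟨hs.1.le, hs.2.trans ht.2⟩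
  simp only [hcl hs']
  gcongr
  exact hnl k s hs'

/-! ### A fixed-point theorem for quadratic maps -/

/-- Banach's fixed-point theorem on the closed ball of radius `R` for a map with quadratic
increments; the fixed point lies in every closed invariant set that contains `0`. -/
lemma exists_fixedPoint_of_quadratic {X : Type*} [NormedAddCommGroup X] [CompleteSpace X]
    {Φ : X → X} {b R : ℝ} (hb : 0 ≤ b) (hR : 0 ≤ R) (hbR : b * R ≤ 1 / 4)
    (hΦ : ∀ U V, ‖Φ U - Φ V‖ ≤ b * ((‖U‖ + ‖V‖) * ‖U - V‖)) (h0 : ‖Φ 0‖ ≤ R / 2)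
    {S : Set X} (hS : IsClosed S) (hS0 : (0 : X) ∈ S) (hSΦ : Set.MapsTo Φ S S) :
    ∃ U ∈ S, Φ U = U := by
  have hmaps : Set.MapsTo Φ (S ∩ Metric.closedBall 0 R) (S ∩ Metric.closedBall 0 R) := by
    rintro U ⟨hU, hUR⟩
    refine ⟨hSΦ hU, ?_⟩
    rw [mem_closedBall_zero_iff] at hUR ⊢
    have h1 := hΦ U 0
    rw [norm_zero, add_zero, sub_zero] at h1
    have h2 : ‖Φ U‖ ≤ ‖Φ U - Φ 0‖ + ‖Φ 0‖ := by simpa using norm_add_le (Φ U - Φ 0) (Φ 0)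
    have h3 : b * (‖U‖ * ‖U‖) ≤ b * (R * R) := by gcongr
    nlinarith
  have hcontr : ContractingWith (1 / 2 : NNReal) (hmaps.restrict Φ _ _) := by
    refine ⟨by norm_num, LipschitzWith.of_dist_le_mul ?_⟩
    rintro ⟨U, hU, hUR⟩ ⟨V, hV, hVR⟩
    rw [mem_closedBall_zero_iff] at hUR hVR
    simp only [Subtype.dist_eq, Set.MapsTo.val_restrict_apply, dist_eq_norm]
    refine (hΦ U V).trans ?_
    have h1 : b * (‖U‖ + ‖V‖) ≤ 1 / 2 := by nlinarith
    have h2 : ((1 / 2 : NNReal) : ℝ) = 1 / 2 := by norm_num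
    rw [← mul_assoc, h2]
    gcongr
  obtain ⟨U, hU, hfix, -⟩ := hcontr.exists_fixedPoint'
    (hS.inter Metric.isClosed_closedBall).isComplete hmaps
    (x := 0) ⟨hS0, by simpa using hR⟩ (edist_ne_top _ _)
  exact ⟨U, hU.1, hfix⟩

/-! ### The heat kernel with a linearly growing exponential weight -/

/-- Since `α x ≤ ν x² / 2 + α² / (2 ν)`, half of the dissipation absorbs the growth of the weight
up to a bounded factor as long as `α² T ≤ ν`. -/
lemma exp_weight_le {ν α T x r : ℝ} (hν : 0 < ν) (hαT : α ^ 2 * T ≤ ν)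
    (hr : r ∈ Set.Icc 0 T) :
    Real.exp ((α * x - ν * x ^ 2) * r) ≤ Real.exp (1 / 2) * Real.exp (-(ν * x ^ 2 / 2 * r)) := by
  rw [← Real.exp_add, Real.exp_le_exp]
  have h1 : α * x ≤ ν * x ^ 2 / 2 + α ^ 2 / (2 * ν) := by
    have : 0 ≤ (ν * x - α) ^ 2 / (2 * ν) := by positivity
    have h : (ν * x - α) ^ 2 / (2 * ν) = ν * x ^ 2 / 2 + α ^ 2 / (2 * ν) - α * x := by
      field_simp; ring
    linarith
  have h2 : α ^ 2 / (2 * ν) * r ≤ 1 / 2 := by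
    rw [div_mul_eq_mul_div, div_le_div_iff₀ (by positivity) (by norm_num)]
    nlinarith [mul_le_mul_of_nonneg_left hr.2 (sq_nonneg α)]
  nlinarith [mul_le_mul_of_nonneg_right h1 hr.1]

/-- The time integral of the kernel gains `√(T / ν)` and absorbs one factor `x`, uniformly in
`x`. -/
lemma mul_integral_exp_weight_le {ν α T x r : ℝ} (hν : 0 < ν) (hαT : α ^ 2 * T ≤ ν)
    (hx : 0 ≤ x) (hr : r ∈ Set.Icc 0 T) :
    x * ∫ s in (0 : ℝ)..r, Real.exp ((α * x - ν * x ^ 2) * (r - s)) ≤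
      5 / 2 * Real.sqrt (T / ν) := by
  set c : ℝ := ν * x ^ 2 / 2 with hc
  have hc0 : 0 ≤ c := by positivity
  set I : ℝ := ∫ s in (0 : ℝ)..r, Real.exp (-(c * (r - s))) with hI
  have hI0 : 0 ≤ I := intervalIntegral.integral_nonneg hr.1 fun s _ => (Real.exp_pos _).le
  have hIT : I ≤ T := by
    have : I ≤ ∫ s in (0 : ℝ)..r, (1 : ℝ) := by
      refine intervalIntegral.integral_mono_on hr.1 (Continuous.intervalIntegrable (by fun_prop) _ _)
        (by simp) fun s hs => ?_
      rw [Real.exp_le_one_iff]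
      nlinarith [hs.2]
    simp only [intervalIntegral.integral_const, sub_zero, smul_eq_mul, mul_one] at this
    exact this.trans hr.2
  have hIc : c * I ≤ 1 := by
    have hd : ∀ s ∈ Set.uIcc 0 r, HasDerivAt (fun s => Real.exp (-(c * (r - s))))
        (c * Real.exp (-(c * (r - s)))) s := fun s _ => by
      have := (((hasDerivAt_id s).const_sub r).const_mul c).neg.exp
      convert! this using 1
      simp; ring
    have := intervalIntegral.integral_eq_sub_of_hasDerivAt hd
      (Continuous.intervalIntegrable (by fun_prop) _ _)
    rw [intervalIntegral.integral_const_mul] at this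
    rw [hI, this]
    simp [Real.exp_nonneg]
  have hle : (∫ s in (0 : ℝ)..r, Real.exp ((α * x - ν * x ^ 2) * (r - s))) ≤
      Real.exp (1 / 2) * I := by
    rw [hI, ← intervalIntegral.integral_const_mul]
    refine intervalIntegral.integral_mono_on hr.1 (Continuous.intervalIntegrable (by fun_prop) _ _)
      (Continuous.intervalIntegrable (by fun_prop) _ _) fun s hs => ?_
    exact exp_weight_le hν hαT ⟨by linarith [hs.2], by linarith [hs.1, hr.2]⟩
  have hT0 : 0 ≤ T := hr.1.trans hr.2
  have hsq : (x * (Real.exp (1 / 2) * I)) ^ 2 ≤ (5 / 2 * Real.sqrt (T / ν)) ^ 2 := by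
    have he : Real.exp (1 / 2) ^ 2 = Real.exp 1 := by rw [← Real.exp_nat_mul]; norm_num
    have hx2 : x ^ 2 * I ^ 2 ≤ 2 * (T / ν) := by
      have : ν * (x ^ 2 * I ^ 2) ≤ 2 * T := by
        have : ν * (x ^ 2 * I ^ 2) = 2 * (c * I) * I := by rw [hc]; ring
        rw [this]
        nlinarith
      rw [← mul_div_assoc, le_div_iff₀ hν]
      linarith
    rw [mul_pow, mul_pow, mul_pow, he, Real.sq_sqrt (by positivity)]
    have h3 := Real.exp_one_lt_d9
    have h4 : 0 ≤ T / ν := by positivity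
    nlinarith [Real.exp_pos 1, mul_le_mul_of_nonneg_left hx2 (Real.exp_pos 1).le]
  calc x * _ ≤ x * (Real.exp (1 / 2) * I) := by gcongr
    _ ≤ _ := le_of_sq_le_sq hsq (by positivity)

/-- The solution of `w' = -γ w + h`, `w 0 = a`, by variation of constants. -/
noncomputable def duhamel {F : Type*} [NormedAddCommGroup F] [NormedSpace ℝ F] (γ : ℝ) (h : ℝ → F)
    (a : F) (t : ℝ) : F :=
  Real.exp (-(γ * t)) • (a + ∫ s in (0 : ℝ)..t, Real.exp (γ * s) • h s)

section Duhamel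

variable {F : Type*} [NormedAddCommGroup F] [NormedSpace ℝ F]

lemma duhamel_zero (γ : ℝ) (h : ℝ → F) (a : F) : duhamel γ h a 0 = a := by simp [duhamel]

lemma hasDerivAt_duhamel [CompleteSpace F] (γ : ℝ) {h : ℝ → F} (hh : Continuous h) (a : F)
    (t : ℝ) : HasDerivAt (duhamel γ h a) (-γ • duhamel γ h a t + h t) t := by
  have h1 : HasDerivAt (fun t => Real.exp (-(γ * t))) (Real.exp (-(γ * t)) * -γ) t := by
    simpa using (((hasDerivAt_id t).const_mul γ).neg).exp
  have hc : Continuous fun s => Real.exp (γ * s) • h s := by fun_prop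
  have h2 := (hc.integral_hasStrictDerivAt 0 t).hasDerivAt.const_add a
  convert! h1.smul h2 using 1
  rw [smul_smul, ← Real.exp_add, neg_add_cancel, Real.exp_zero, one_smul, duhamel, smul_smul,
    mul_comm, add_comm]

lemma exp_mul_norm_duhamel_sub_le {ν α T x r H : ℝ} (hν : 0 < ν)
    (hαT : α ^ 2 * T ≤ ν) (hx : 0 ≤ x) (hr : r ∈ Set.Icc 0 T) (hH : 0 ≤ H) {h₁ h₂ : ℝ → F}
    (hh₁ : Continuous h₁) (hh₂ : Continuous h₂) (a : F)
    (hle : ∀ s ∈ Set.Icc 0 T, ‖h₁ s - h₂ s‖ ≤ x * (Real.exp (-(α * x * s)) * H)) :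
    Real.exp (α * x * r) * ‖duhamel (ν * x ^ 2) h₁ a r - duhamel (ν * x ^ 2) h₂ a r‖ ≤
      5 / 2 * Real.sqrt (T / ν) * H := by
  set γ : ℝ := ν * x ^ 2 with hγ
  have hi₁ : IntervalIntegrable (fun s => Real.exp (γ * s) • h₁ s) MeasureTheory.volume 0 r :=
    Continuous.intervalIntegrable (by fun_prop) _ _
  have hi₂ : IntervalIntegrable (fun s => Real.exp (γ * s) • h₂ s) MeasureTheory.volume 0 r :=
    Continuous.intervalIntegrable (by fun_prop) _ _
  have heq : duhamel γ h₁ a r - duhamel γ h₂ a r =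
      Real.exp (-(γ * r)) • ∫ s in (0 : ℝ)..r, Real.exp (γ * s) • (h₁ s - h₂ s) := by
    simp only [smul_sub]
    rw [duhamel, duhamel, ← smul_sub, intervalIntegral.integral_sub hi₁ hi₂]
    congr 1
    abel
  have hint : ‖∫ s in (0 : ℝ)..r, Real.exp (γ * s) • (h₁ s - h₂ s)‖ ≤
      ∫ s in (0 : ℝ)..r, Real.exp (γ * s) * (x * (Real.exp (-(α * x * s)) * H)) := by
    refine intervalIntegral.norm_integral_le_of_norm_le hr.1 (Filter.Eventually.of_forall ?_)
      (Continuous.intervalIntegrable (by fun_prop) _ _)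
    intro s hs
    rw [norm_smul, Real.norm_of_nonneg (Real.exp_pos _).le]
    gcongr
    exact hle s ⟨hs.1.le, hs.2.trans hr.2⟩
  calc Real.exp (α * x * r) * ‖duhamel γ h₁ a r - duhamel γ h₂ a r‖
      ≤ Real.exp (α * x * r) * (Real.exp (-(γ * r)) *
          ∫ s in (0 : ℝ)..r, Real.exp (γ * s) * (x * (Real.exp (-(α * x * s)) * H))) := by
        rw [heq, norm_smul, Real.norm_of_nonneg (Real.exp_pos _).le]
        gcongr
    _ = (x * ∫ s in (0 : ℝ)..r, Real.exp ((α * x - γ) * (r - s))) * H := by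
        rw [← intervalIntegral.integral_const_mul, ← intervalIntegral.integral_const_mul,
          ← intervalIntegral.integral_const_mul, ← intervalIntegral.integral_mul_const]
        congr 1
        funext s
        have : Real.exp ((α * x - γ) * (r - s)) = Real.exp (α * x * r) * (Real.exp (-(γ * r)) *
            (Real.exp (γ * s) * Real.exp (-(α * x * s)))) := by
          simp only [← Real.exp_add]
          ring_nf
        rw [this]
        ring
    _ ≤ _ := mul_le_mul_of_nonneg_right (mul_integral_exp_weight_le hν hαT hx hr) hH

lemma exp_mul_norm_duhamel_const_le {ν α T x r : ℝ} (hν : 0 < ν) (hα : 0 ≤ α)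
    (hαT : α ^ 2 * T ≤ ν) (hx : 0 ≤ x) (hr : r ∈ Set.Icc 0 T) (a g : F) :
    Real.exp (α * x * r) * ‖duhamel (ν * x ^ 2) (fun _ => g) a r‖ ≤
      2 * ‖a‖ + T * (Real.exp (α * x * T) * ‖g‖) := by
  set γ : ℝ := ν * x ^ 2 with hγ
  have hγ0 : 0 ≤ γ := by positivity
  have hT0 : 0 ≤ T := hr.1.trans hr.2
  have h1 : Real.exp (α * x * r) * Real.exp (-(γ * r)) ≤ 2 := by
    rw [← Real.exp_add]
    have := exp_weight_le (x := x) hν hαT hr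
    rw [show α * x * r + -(γ * r) = (α * x - ν * x ^ 2) * r by rw [hγ]; ring]
    refine this.trans ?_
    have h2 : Real.exp (-(ν * x ^ 2 / 2 * r)) ≤ 1 := by
      rw [Real.exp_le_one_iff]
      have := hr.1
      have : 0 ≤ ν * x ^ 2 / 2 * r := by positivity
      linarith
    have h3 : Real.exp (1 / 2) ≤ 2 := by
      have he : Real.exp (1 / 2) ^ 2 = Real.exp 1 := by rw [← Real.exp_nat_mul]; norm_num
      nlinarith [Real.exp_one_lt_d9, Real.exp_pos (1 / 2)]
    nlinarith [Real.exp_pos (1 / 2)]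
  have h2 : ‖∫ s in (0 : ℝ)..r, Real.exp (γ * s) • g‖ ≤ Real.exp (γ * r) * ‖g‖ * |r - 0| := by
    refine intervalIntegral.norm_integral_le_of_norm_le_const fun s hs => ?_
    rw [Set.uIoc_of_le hr.1] at hs
    rw [norm_smul, Real.norm_of_nonneg (Real.exp_pos _).le]
    gcongr
    exact hs.2
  rw [sub_zero, abs_of_nonneg hr.1] at h2
  have h3 : Real.exp (-(γ * r)) * Real.exp (γ * r) = 1 := by rw [← Real.exp_add]; simp
  calc Real.exp (α * x * r) * ‖duhamel γ (fun _ => g) a r‖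
      ≤ Real.exp (α * x * r) * (Real.exp (-(γ * r)) * (‖a‖ + Real.exp (γ * r) * ‖g‖ * r)) := by
        rw [duhamel, norm_smul, Real.norm_of_nonneg (Real.exp_pos _).le]
        gcongr
        exact (norm_add_le _ _).trans (by gcongr)
    _ = (Real.exp (α * x * r) * Real.exp (-(γ * r))) * ‖a‖ + r * (Real.exp (α * x * r) * ‖g‖) *
          (Real.exp (-(γ * r)) * Real.exp (γ * r)) := by ring
    _ ≤ 2 * ‖a‖ + T * (Real.exp (α * x * T) * ‖g‖) := by
        rw [h3, mul_one]
        have := hr.2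
        gcongr

end Duhamel

/-! ### The space of weighted paths -/

/-- Absolutely summable families of bounded continuous paths: the norm is `∑ₖ supₜ ‖U k t‖`, with
the supremum in time taken inside the sum. -/
abbrev PathSpace (n : ℕ) : Type :=
  lp (fun _ : Fin n → ℤ => BoundedContinuousFunction ℝ (EuclideanSpace ℂ (Fin n))) 1

lemma PathSpace.hasSum_norm {n : ℕ} (U : PathSpace n) : HasSum (fun k => ‖U k‖) ‖U‖ := by
  have h := lp.hasSum_norm (p := 1) (by simp) U
  simpa using h

lemma PathSpace.norm_apply_le {n : ℕ} (U : PathSpace n) (k : Fin n → ℤ) (t : ℝ) :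
    ‖U k t‖ ≤ ‖U k‖ := (U k).norm_coe_le_norm t

/-- A family of continuous paths with absolutely summable bounds is an element of the path space. -/
lemma PathSpace.exists_of_norm_le {n : ℕ} {F : (Fin n → ℤ) → ℝ → EuclideanSpace ℂ (Fin n)}
    {a : (Fin n → ℤ) → ℝ} (hF : ∀ k, Continuous (F k)) (ha : Summable a)
    (hFa : ∀ k t, ‖F k t‖ ≤ a k) : ∃ U : PathSpace n, ∀ k t, U k t = F k t := by
  let W : ∀ _ : Fin n → ℤ, BoundedContinuousFunction ℝ (EuclideanSpace ℂ (Fin n)) := fun k =>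
    BoundedContinuousFunction.ofNormedAddCommGroup (F k) (hF k) (a k) (hFa k)
  have hW : ∀ k, ‖W k‖ ≤ a k := fun k =>
    (W k).norm_le ((norm_nonneg _).trans (hFa k 0)) |>.mpr (hFa k)
  refine ⟨⟨W, memℓp_gen ?_⟩, fun k t => rfl⟩
  simpa using Summable.of_nonneg_of_le (fun k => norm_nonneg (W k)) hW ha

lemma PathSpace.norm_le_of_hasSum {n : ℕ} {U : PathSpace n} {a : (Fin n → ℤ) → ℝ} {A : ℝ}
    (ha : HasSum a A) (hU : ∀ k t, ‖U k t‖ ≤ a k) : ‖U‖ ≤ A :=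
  hasSum_le (fun k => (U k).norm_le ((norm_nonneg _).trans (hU k 0)) |>.mpr (hU k))
    U.hasSum_norm ha

lemma PathSpace.continuous_eval {n : ℕ} (k : Fin n → ℤ) (t : ℝ) :
    Continuous fun U : PathSpace n => U k t := by
  refine LipschitzWith.continuous (K := 1) (LipschitzWith.of_dist_le_mul fun U V => ?_)
  rw [dist_eq_norm, dist_eq_norm, NNReal.coe_one, one_mul]
  calc ‖U k t - V k t‖ = ‖(U - V) k t‖ := rfl
    _ ≤ ‖(U - V) k‖ := (U - V).norm_apply_le k t
    _ ≤ ‖U - V‖ := lp.norm_apply_le_norm (by simp) _ _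

/-- The Fourier coefficients `û(k, t) = e^{-α κ₀ |k| t} U(k, t)`, `t ∈ [0, T]`, encoded by a weighted
path. -/
noncomputable def unweight {n : ℕ} (κ₀ α T : ℝ) (U : PathSpace n) (t : ℝ) : CoeffSeq n :=
  fun k => Real.exp (-(α * (κ₀ * waveAbs k) * clampTime T t)) • U k t

/-- The source term `f - B[u, u]` in the equation of the mode `k`. -/
noncomputable def source {n : ℕ} (κ₀ α T : ℝ) (f : CoeffSeq n) (U : PathSpace n)
    (k : Fin n → ℤ) (s : ℝ) : EuclideanSpace ℂ (Fin n) :=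
  f k - bilin κ₀ (unweight κ₀ α T U s) (unweight κ₀ α T U s) k

/-- The weighted path of the right-hand side of the mild formulation. -/
noncomputable def mildMap {n : ℕ} (ν κ₀ α T : ℝ) (f u₀ : CoeffSeq n) (U : PathSpace n)
    (k : Fin n → ℤ) (t : ℝ) : EuclideanSpace ℂ (Fin n) :=
  Real.exp (α * (κ₀ * waveAbs k) * clampTime T t) •
    duhamel (ν * (κ₀ * waveAbs k) ^ 2) (source κ₀ α T f U k) (u₀ k) (clampTime T t)

section PathSpaceEstimates

variable {n : ℕ} {ν κ₀ α T : ℝ}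

lemma norm_unweight_le (U : PathSpace n) (t : ℝ) (k : Fin n → ℤ) :
    ‖unweight κ₀ α T U t k‖ ≤
      Real.exp (-(α * κ₀ * clampTime T t * waveAbs k)) * ‖U k‖ := by
  rw [unweight, norm_smul, Real.norm_of_nonneg (Real.exp_pos _).le]
  rw [show α * (κ₀ * waveAbs k) * clampTime T t = α * κ₀ * clampTime T t * waveAbs k by ring]
  gcongr
  exact U.norm_apply_le k t

lemma unweight_sub (U V : PathSpace n) (t : ℝ) :
    unweight κ₀ α T U t - unweight κ₀ α T V t = unweight κ₀ α T (U - V) t := by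
  funext k
  simp only [unweight, Pi.sub_apply, ← smul_sub]
  rfl

lemma weight_nonneg (hκ₀ : 0 ≤ κ₀) (hα : 0 ≤ α) (t : ℝ) : 0 ≤ α * κ₀ * clampTime T t :=
  mul_nonneg (mul_nonneg hα hκ₀) (le_max_left _ _)

lemma norm_unweight_le_norm (hκ₀ : 0 ≤ κ₀) (hα : 0 ≤ α) (U : PathSpace n) (t : ℝ)
    (k : Fin n → ℤ) : ‖unweight κ₀ α T U t k‖ ≤ ‖U k‖ := by
  refine (norm_unweight_le U t k).trans (mul_le_of_le_one_left (norm_nonneg _) ?_)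
  rw [Real.exp_le_one_iff, neg_nonpos]
  exact mul_nonneg (weight_nonneg hκ₀ hα t) (waveAbs_nonneg k)

lemma continuous_unweight (U : PathSpace n) (k : Fin n → ℤ) :
    Continuous fun t => unweight κ₀ α T U t k := by
  have := continuous_clampTime T
  have := (U k).continuous
  unfold unweight
  fun_prop

lemma continuous_source (hκ₀ : 0 ≤ κ₀) (hα : 0 ≤ α) (f : CoeffSeq n) (U : PathSpace n)
    (k : Fin n → ℤ) : Continuous (source κ₀ α T f U k) := by
  have hsum : Continuous fun s => ∑' l : {l : Fin n → ℤ // l ≠ 0},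
      bilinTerm (unweight κ₀ α T U s) (unweight κ₀ α T U s) k l := by
    refine continuous_tsum (u := fun l : {l : Fin n → ℤ // l ≠ 0} =>
      waveAbs k * (‖U (l : Fin n → ℤ)‖ * ‖U (k - l)‖)) (fun l => ?_) ?_ (fun l s => ?_)
    · unfold bilinTerm
      exact ((continuous_waveDot k).comp (continuous_unweight U l)).smul
        (continuous_unweight U (k - l))
    · exact ((summable_mul_comp_sub U.hasSum_norm.summable U.hasSum_norm.summable
        (fun _ => norm_nonneg _) (fun _ => norm_nonneg _) k).mul_left _).comp_injective
          Subtype.val_injective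
    · refine (norm_bilinTerm_le _ _ _ _).trans ?_
      have := waveAbs_nonneg k
      gcongr
      · exact norm_unweight_le_norm hκ₀ hα U s _
      · exact norm_unweight_le_norm hκ₀ hα U s _
  have hleray : Continuous fun s => leray k (∑' l : {l : Fin n → ℤ // l ≠ 0},
      bilinTerm (unweight κ₀ α T U s) (unweight κ₀ α T U s) k l) := (continuous_leray k).comp hsum
  unfold source bilin
  fun_prop

lemma continuous_mildMap (hκ₀ : 0 ≤ κ₀) (hα : 0 ≤ α) (f u₀ : CoeffSeq n) (U : PathSpace n)
    (k : Fin n → ℤ) : Continuous (mildMap ν κ₀ α T f u₀ U k) := by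
  have h1 := continuous_clampTime T
  have h2 : Continuous (duhamel (ν * (κ₀ * waveAbs k) ^ 2) (source κ₀ α T f U k) (u₀ k)) :=
    continuous_iff_continuousAt.mpr fun t =>
      (hasDerivAt_duhamel _ (continuous_source hκ₀ hα f U k) _ t).continuousAt
  have h3 : Continuous fun t => Real.exp (α * (κ₀ * waveAbs k) * clampTime T t) := by fun_prop
  exact h3.smul (h2.comp h1)

lemma norm_mildMap_sub_le (hν : 0 < ν) (hκ₀ : 0 ≤ κ₀) (hα : 0 ≤ α) (hT : 0 ≤ T)
    (hαT : α ^ 2 * T ≤ ν) (f u₀ : CoeffSeq n) (U V : PathSpace n) (k : Fin n → ℤ) (t : ℝ) :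
    ‖mildMap ν κ₀ α T f u₀ U k t - mildMap ν κ₀ α T f u₀ V k t‖ ≤
      5 * Real.sqrt (T / ν) * ((∑' l, ‖(U - V) l‖ * ‖U (k - l)‖) +
        ∑' l, ‖V l‖ * ‖(U - V) (k - l)‖) := by
  set H := (∑' l, ‖(U - V) l‖ * ‖U (k - l)‖) + ∑' l, ‖V l‖ * ‖(U - V) (k - l)‖ with hH
  have hH0 : 0 ≤ H := add_nonneg (tsum_nonneg fun _ => by positivity)
    (tsum_nonneg fun _ => by positivity)
  have hx : 0 ≤ κ₀ * waveAbs k := mul_nonneg hκ₀ (waveAbs_nonneg k)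
  have hsrc : ∀ s ∈ Set.Icc 0 T, ‖source κ₀ α T f U k s - source κ₀ α T f V k s‖ ≤
      κ₀ * waveAbs k * (Real.exp (-(α * (κ₀ * waveAbs k) * s)) * (2 * H)) := fun s hs => by
    have h := norm_bilin_sub_le hκ₀ (weight_nonneg (T := T) hκ₀ hα s)
      U.hasSum_norm.summable V.hasSum_norm.summable (U - V).hasSum_norm.summable
      (fun l => norm_unweight_le U s l) (fun l => norm_unweight_le V s l)
      (fun l => by rw [unweight_sub]; exact norm_unweight_le (U - V) s l) k
    rw [source, source, sub_sub_sub_cancel_left, norm_sub_rev]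
    refine h.trans (le_of_eq ?_)
    rw [clampTime_of_mem hs,
      show α * (κ₀ * waveAbs k) * s = α * κ₀ * s * waveAbs k by ring]
    ring
  have := exp_mul_norm_duhamel_sub_le hν hαT hx (clampTime_mem hT t)
    (by positivity : (0 : ℝ) ≤ 2 * H) (continuous_source hκ₀ hα f U k)
    (continuous_source hκ₀ hα f V k) (u₀ k) hsrc
  rw [mildMap, mildMap, ← smul_sub, norm_smul, Real.norm_of_nonneg (Real.exp_pos _).le]
  refine this.trans (le_of_eq (by ring))

lemma unweight_zero (s : ℝ) : unweight κ₀ α T (0 : PathSpace n) s = 0 := by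
  funext k; simp [unweight]

lemma norm_mildMap_zero_le (hν : 0 < ν) (hκ₀ : 0 ≤ κ₀) (hα : 0 ≤ α) (hT : 0 ≤ T)
    (hαT : α ^ 2 * T ≤ ν) {f u₀ : CoeffSeq n} {Q : ℝ}
    (hf : ∀ k, f k ≠ 0 → α * (κ₀ * waveAbs k) * T ≤ Q) (k : Fin n → ℤ) (t : ℝ) :
    ‖mildMap ν κ₀ α T f u₀ 0 k t‖ ≤ 2 * ‖u₀ k‖ + T * (Real.exp Q * ‖f k‖) := by
  have hsrc : source κ₀ α T f 0 k = fun _ => f k := by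
    funext s
    simp only [source, unweight_zero, bilin_zero, sub_zero]
  rw [mildMap, hsrc, norm_smul, Real.norm_of_nonneg (Real.exp_pos _).le]
  refine (exp_mul_norm_duhamel_const_le hν hα hαT (mul_nonneg hκ₀ (waveAbs_nonneg k))
    (clampTime_mem hT t) (u₀ k) (f k)).trans ?_
  by_cases hk : f k = 0
  · simp [hk]
  · gcongr
    exact hf k hk

lemma mildMap_neg_conj (f u₀ : CoeffSeq n)
    (hf : ∀ k, f (-k) = conjIso n (f k)) (hu₀ : ∀ k, u₀ (-k) = conjIso n (u₀ k)) {U : PathSpace n}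
    (hU : ∀ k t, U (-k) t = conjIso n (U k t)) (k : Fin n → ℤ) (t : ℝ) :
    mildMap ν κ₀ α T f u₀ U (-k) t = conjIso n (mildMap ν κ₀ α T f u₀ U k t) := by
  have hu : ∀ s k, unweight κ₀ α T U s (-k) = conjIso n (unweight κ₀ α T U s k) := fun s k => by
    rw [unweight, unweight, waveAbs_neg, hU, map_smul]
  have hsrc : ∀ s, source κ₀ α T f U (-k) s = conjIso n (source κ₀ α T f U k s) := fun s => by
    rw [source, source, hf, bilin_neg_conj κ₀ (hu s), map_sub]
  have hint : ∀ (γ r : ℝ), ∫ s in (0 : ℝ)..r, Real.exp (γ * s) • source κ₀ α T f U (-k) s =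
      conjIso n (∫ s in (0 : ℝ)..r, Real.exp (γ * s) • source κ₀ α T f U k s) := fun γ r => by
    simp only [hsrc, ← map_smul, intervalIntegral]
    have h := fun S : Set ℝ => (conjIso n).toContinuousLinearEquiv.integral_comp_comm
      (μ := MeasureTheory.volume.restrict S)
      (fun s => Real.exp (γ * s) • source κ₀ α T f U k s)
    simp only [LinearIsometryEquiv.coe_toContinuousLinearEquiv] at h
    rw [h, h, map_sub]
  simp only [mildMap, duhamel, waveAbs_neg, hint, hu₀, map_smul, map_add]

/-- The mild formulation has a real solution in the path space when the data are small compared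
with `√(ν / T)`. -/
theorem exists_mild_solution (hν : 0 < ν) (hκ₀ : 0 ≤ κ₀) (hα : 0 ≤ α) (hT : 0 ≤ T)
    (hαT : α ^ 2 * T ≤ ν) {f u₀ : CoeffSeq n} {Q R : ℝ}
    (hfQ : ∀ k, f k ≠ 0 → α * (κ₀ * waveAbs k) * T ≤ Q)
    (hf : ∀ k, f (-k) = conjIso n (f k)) (hu₀ : ∀ k, u₀ (-k) = conjIso n (u₀ k))
    (hfs : Summable fun k => ‖f k‖) (hu₀s : Summable fun k => ‖u₀ k‖)
    (hR : 0 ≤ R) (hbR : 5 * Real.sqrt (T / ν) * R ≤ 1 / 4)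
    (hdata : 2 * (∑' k, ‖u₀ k‖) + T * (Real.exp Q * ∑' k, ‖f k‖) ≤ R / 2) :
    ∃ U : PathSpace n, (∀ k t, mildMap ν κ₀ α T f u₀ U k t = U k t) ∧
      ∀ k t, U (-k) t = conjIso n (U k t) := by
  have hconv : ∀ U V : PathSpace n, HasSum (fun k => 5 * Real.sqrt (T / ν) *
      ((∑' l, ‖(U - V) l‖ * ‖U (k - l)‖) + ∑' l, ‖V l‖ * ‖(U - V) (k - l)‖))
      (5 * Real.sqrt (T / ν) * ((‖U‖ + ‖V‖) * ‖U - V‖)) := fun U V => by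
    have h1 := hasSum_convolution (U - V).hasSum_norm.summable U.hasSum_norm.summable
      (fun _ => norm_nonneg _) (fun _ => norm_nonneg _)
    have h2 := hasSum_convolution V.hasSum_norm.summable (U - V).hasSum_norm.summable
      (fun _ => norm_nonneg _) (fun _ => norm_nonneg _)
    convert! (h1.add h2).mul_left (5 * Real.sqrt (T / ν)) using 1
    rw [U.hasSum_norm.tsum_eq, V.hasSum_norm.tsum_eq, (U - V).hasSum_norm.tsum_eq]
    ring
  have hzero : HasSum (fun k => 2 * ‖u₀ k‖ + T * (Real.exp Q * ‖f k‖))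
      (2 * (∑' k, ‖u₀ k‖) + T * (Real.exp Q * ∑' k, ‖f k‖)) :=
    (hu₀s.hasSum.mul_left 2).add ((hfs.hasSum.mul_left _).mul_left T)
  have hdiff := norm_mildMap_sub_le hν hκ₀ hα hT hαT f u₀
  have h0 := norm_mildMap_zero_le (u₀ := u₀) hν hκ₀ hα hT hαT hfQ
  have hex : ∀ U : PathSpace n, ∃ W : PathSpace n, ∀ k t, W k t = mildMap ν κ₀ α T f u₀ U k t :=
    fun U => by
      refine PathSpace.exists_of_norm_le (fun k => continuous_mildMap hκ₀ hα f u₀ U k)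
        ((hconv U 0).add hzero).summable fun k t => ?_
      have h1 := hdiff U 0 k t
      have h2 := norm_add_le (mildMap ν κ₀ α T f u₀ U k t - mildMap ν κ₀ α T f u₀ 0 k t)
        (mildMap ν κ₀ α T f u₀ 0 k t)
      rw [sub_add_cancel] at h2
      exact h2.trans (add_le_add h1 (h0 k t))
  choose Φ hΦ using hex
  obtain ⟨U, hU, hfix⟩ := exists_fixedPoint_of_quadratic (Φ := Φ) (R := R)
    (b := 5 * Real.sqrt (T / ν)) (by positivity) hR hbR
    (fun U V => PathSpace.norm_le_of_hasSum (hconv U V) fun k t => by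
      have : (Φ U - Φ V) k t = Φ U k t - Φ V k t := rfl
      rw [this, hΦ, hΦ]
      exact hdiff U V k t)
    ((PathSpace.norm_le_of_hasSum hzero fun k t => by rw [hΦ]; exact h0 k t).trans hdata)
    (S := {U | ∀ k t, U (-k) t = conjIso n (U k t)})
    (by
      simp only [Set.ofPred_forall]
      exact isClosed_iInter fun k => isClosed_iInter fun t => isClosed_eq
        (PathSpace.continuous_eval _ _)
        ((conjIso n).continuous.comp (PathSpace.continuous_eval _ _)))
    (fun k t => by simp)
    (fun U hU k t => by rw [hΦ, hΦ]; exact mildMap_neg_conj f u₀ hf hu₀ hU k t)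
  exact ⟨U, fun k t => by rw [← hΦ, hfix], hU⟩

end PathSpaceEstimates

/-! ### From mild solutions to weak solutions -/

lemma neg_eq_conj_of_mem_divFree {n : ℕ} {u : CoeffSeq n} (hu : u ∈ DivFree n) (k : Fin n → ℤ) :
    u (-k) = conjIso n (u k) := by
  ext j
  rw [hu.2.1 (-k) j, neg_neg]
  rfl

section MildSolution

variable {n : ℕ} {ν κ₀ α T : ℝ} {f u₀ : CoeffSeq n} {U : PathSpace n}

lemma unweight_eq_duhamel (hU : ∀ k t, mildMap ν κ₀ α T f u₀ U k t = U k t) (t : ℝ)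
    (k : Fin n → ℤ) : unweight κ₀ α T U t k =
      duhamel (ν * (κ₀ * waveAbs k) ^ 2) (source κ₀ α T f U k) (u₀ k) (clampTime T t) := by
  rw [unweight, ← hU, mildMap, smul_smul, ← Real.exp_add, neg_add_cancel, Real.exp_zero, one_smul]

lemma waveDot_duhamel {h : ℝ → EuclideanSpace ℂ (Fin n)} {a : EuclideanSpace ℂ (Fin n)}
    {k : Fin n → ℤ} (hh : Continuous h) (hdiv : ∀ s, waveDot k (h s) = 0) (ha : waveDot k a = 0)
    (γ t : ℝ) : waveDot k (duhamel γ h a t) = 0 := by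
  have hi : IntervalIntegrable (fun s => Real.exp (γ * s) • h s) MeasureTheory.volume 0 t :=
    Continuous.intervalIntegrable (by fun_prop) _ _
  rw [waveDot_eq_inner] at ha ⊢
  simp only [waveDot_eq_inner] at hdiv
  have h1 := (innerSL ℂ (waveVec k)).intervalIntegral_comp_comm hi
  simp only [innerSL_apply_apply, inner_smul_right_eq_smul, hdiv, smul_zero,
    intervalIntegral.integral_zero] at h1
  rw [duhamel, inner_smul_right_eq_smul, inner_add_right, ha, ← h1]
  simp

lemma unweight_mem_divFree (hκ₀ : 0 ≤ κ₀) (hα : 0 ≤ α) (hf : f ∈ DivFree n)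
    (hu₀ : u₀ ∈ DivFree n) (hU : ∀ k t, mildMap ν κ₀ α T f u₀ U k t = U k t)
    (hUr : ∀ k t, U (-k) t = conjIso n (U k t)) (t : ℝ) : unweight κ₀ α T U t ∈ DivFree n := by
  refine ⟨?_, fun k j => ?_, fun k => ?_⟩
  · rw [unweight_eq_duhamel hU]
    have : source κ₀ α T f U 0 = fun _ => 0 := by
      funext s; rw [source, hf.1, bilin_zero_mode, sub_zero]
    simp [this, duhamel, hu₀.1]
  · have : U k t = conjIso n (U (-k) t) := by rw [← hUr, neg_neg]
    rw [unweight, unweight, waveAbs_neg, this, ← map_smul, conjIso_apply]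
  · rw [unweight_eq_duhamel hU]
    refine waveDot_duhamel (continuous_source hκ₀ hα f U k) (fun s => ?_) (hu₀.2.2 k) _ _
    rw [source, waveDot_sub, hf.2.2, waveDot_bilin, sub_zero]

lemma summable_norm_unweight (hκ₀ : 0 ≤ κ₀) (hα : 0 ≤ α) (U : PathSpace n) (t : ℝ) :
    Summable fun k => ‖unweight κ₀ α T U t k‖ :=
  Summable.of_nonneg_of_le (fun _ => norm_nonneg _) (fun k => norm_unweight_le_norm hκ₀ hα U t k)
    U.hasSum_norm.summable

theorem isWeakSolution_unweight (hκ₀ : 0 ≤ κ₀) (hα : 0 ≤ α) (hT : 0 ≤ T)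
    (hf : f ∈ DivFree n) (hu₀ : u₀ ∈ DivFree n)
    (hU : ∀ k t, mildMap ν κ₀ α T f u₀ U k t = U k t)
    (hUr : ∀ k t, U (-k) t = conjIso n (U k t)) :
    IsWeakSolution ν κ₀ T f u₀ (unweight κ₀ α T U) where
  mem t _ := unweight_mem_divFree hκ₀ hα hf hu₀ hU hUr t
  cont := (continuous_pi fun k => continuous_unweight U k).continuousOn
  init := by
    funext k
    rw [unweight_eq_duhamel hU, clampTime_of_mem ⟨le_rfl, hT⟩, duhamel_zero]
  ac k := by
    set γ := ν * (κ₀ * waveAbs k) ^ 2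
    have hder := hasDerivAt_duhamel γ (continuous_source (T := T) hκ₀ hα f U k) (u₀ k)
    have hC : ContDiff ℝ 1 (duhamel γ (source κ₀ α T f U k) (u₀ k)) := by
      rw [contDiff_one_iff_deriv]
      refine ⟨fun t => (hder t).differentiableAt, ?_⟩
      have hd : deriv (duhamel γ (source κ₀ α T f U k) (u₀ k)) = fun t =>
          -γ • duhamel γ (source κ₀ α T f U k) (u₀ k) t + source κ₀ α T f U k t :=
        funext fun t => (hder t).deriv
      rw [hd]
      have h1 : Continuous (duhamel γ (source κ₀ α T f U k) (u₀ k)) :=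
        continuous_iff_continuousAt.mpr fun t => (hder t).continuousAt
      have h2 := continuous_source (T := T) hκ₀ hα f U k
      fun_prop
    refine ContDiffOn.absolutelyContinuousOnInterval (hC.contDiffOn.congr fun t ht => ?_)
    rw [Set.uIcc_of_le hT] at ht
    rw [unweight_eq_duhamel hU, clampTime_of_mem ht]
  summable k := Filter.Eventually.of_forall fun t =>
    (summable_bilinTerm (summable_norm_unweight hκ₀ hα U t) (summable_norm_unweight hκ₀ hα U t)
      k).comp_injective Subtype.val_injective
  eqn k := by
    rw [← MeasureTheory.restrict_Ioo_eq_restrict_Icc]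
    refine (MeasureTheory.ae_restrict_iff' measurableSet_Ioo).mpr
      (Filter.Eventually.of_forall fun t ht => ?_)
    have hev : (fun s => unweight κ₀ α T U s k) =ᶠ[nhds t]
        duhamel (ν * (κ₀ * waveAbs k) ^ 2) (source κ₀ α T f U k) (u₀ k) := by
      filter_upwards [Ioo_mem_nhds ht.1 ht.2] with s hs
      rw [unweight_eq_duhamel hU, clampTime_of_mem ⟨hs.1.le, hs.2.le⟩]
    have hder := (hasDerivAt_duhamel (ν * (κ₀ * waveAbs k) ^ 2)
      (continuous_source hκ₀ hα f U k) (u₀ k) t).congr_of_eventuallyEq hev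
    convert! hder using 1
    rw [← hev.eq_of_nhds, source, ← Complex.ofReal_neg, Complex.coe_smul,
      show ν * κ₀ ^ 2 * waveAbs k ^ 2 = ν * (κ₀ * waveAbs k) ^ 2 by ring]
    abel

theorem continuousIntoSob_unweight (hκ₀ : 0 ≤ κ₀) (hα : 0 ≤ α) (U : PathSpace n)
    (hmem : ∀ t, unweight κ₀ α T U t ∈ DivFree n) :
    ContinuousIntoSob κ₀ 0 T (unweight κ₀ α T U) := by
  refine ⟨fun t _ => ⟨hmem t, ?_⟩, fun t₀ _ => ?_⟩
  · rw [sobNorm_zero, tsum_enorm_eq_ofReal (summable_norm_unweight hκ₀ hα U t)]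
    exact ENNReal.ofReal_lt_top
  · have hle : ∀ t k, ‖(unweight κ₀ α T U t - unweight κ₀ α T U t₀) k‖ ≤ ‖U k‖ + ‖U k‖ :=
      fun t k => (norm_sub_le _ _).trans (add_le_add (norm_unweight_le_norm hκ₀ hα U t k)
        (norm_unweight_le_norm hκ₀ hα U t₀ k))
    have hs : Summable fun k => ‖U k‖ + ‖U k‖ := U.hasSum_norm.summable.add U.hasSum_norm.summable
    have heq : (fun t => sobNorm κ₀ 0 (unweight κ₀ α T U t - unweight κ₀ α T U t₀)) = fun t =>
        ENNReal.ofReal (∑' k, ‖(unweight κ₀ α T U t - unweight κ₀ α T U t₀) k‖) := by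
      funext t
      rw [sobNorm_zero, tsum_enorm_eq_ofReal
        (Summable.of_nonneg_of_le (fun _ => norm_nonneg _) (hle t) hs)]
    rw [heq]
    have hlim : Filter.Tendsto
        (fun t => ∑' k, ‖(unweight κ₀ α T U t - unweight κ₀ α T U t₀) k‖) (nhds t₀)
        (nhds (∑' _ : Fin n → ℤ, (0 : ℝ))) := by
      refine tendsto_tsum_of_dominated_convergence hs (fun k => ?_)
        (Filter.Eventually.of_forall fun t k => by simpa using hle t k)
      have h := (((continuous_unweight (κ₀ := κ₀) (α := α) (T := T) U k).sub
        continuous_const).norm (E := EuclideanSpace ℂ (Fin n))).tendsto' t₀ 0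
        (f := fun t => ‖unweight κ₀ α T U t k - unweight κ₀ α T U t₀ k‖) (by simp)
      exact h
    rw [tsum_zero] at hlim
    simpa using (ENNReal.tendsto_ofReal hlim).mono_left nhdsWithin_le_nhds

lemma gevreyNorm_unweight_le (U : PathSpace n) {t : ℝ} (ht : t ∈ Set.Icc 0 T) :
    gevreyNorm κ₀ (α * t) 0 (unweight κ₀ α T U t) ≤ ENNReal.ofReal ‖U‖ := by
  rw [← U.hasSum_norm.tsum_eq,
    ENNReal.ofReal_tsum_of_nonneg (fun _ => norm_nonneg _) U.hasSum_norm.summable]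
  refine ENNReal.tsum_le_tsum fun k => ENNReal.ofReal_le_ofReal ?_
  rw [Real.rpow_zero, Real.rpow_zero, one_mul, mul_one, unweight, norm_smul,
    Real.norm_of_nonneg (Real.exp_pos _).le, clampTime_of_mem ht, ← mul_assoc, ← Real.exp_add,
    show α * t * κ₀ * waveAbs k + -(α * (κ₀ * waveAbs k) * t) = 0 by ring, Real.exp_zero, one_mul]
  exact U.norm_apply_le k t

lemma gevreyRegular_unweight (hα : 0 < α) (U : PathSpace n) :
    GevreyRegular κ₀ T (unweight κ₀ α T U) := by
  refine ⟨0, fun t => α.toNNReal * t, fun s t hst => by dsimp only; gcongr, fun s t =>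
    (mul_add _ s t).le, fun t ht => mul_pos (Real.toNNReal_pos.mpr hα) ht, ?_⟩
  refine lt_of_le_of_lt (iSup₂_le fun t ht => ?_) (ENNReal.ofReal_lt_top (r := ‖U‖))
  have := gevreyNorm_unweight_le (κ₀ := κ₀) (α := α) U ht
  rwa [NNReal.coe_mul, Real.coe_toNNReal _ hα.le, Real.coe_toNNReal _ ht.1]

lemma le_analyticityRadius_unweight (hα : 0 < α) (hT : 0 < T) (U : PathSpace n) :
    ENNReal.ofReal (α * T) ≤ analyticityRadius κ₀ 0 (unweight κ₀ α T U T) :=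
  le_sSup ⟨α * T, mul_pos hα hT, (gevreyNorm_unweight_le U ⟨hT.le, le_rfl⟩).trans_lt
    ENNReal.ofReal_lt_top, rfl⟩

end MildSolution

/-! ### Fourier coefficients and the `L²` norm -/

/-- The character `x ↦ e^{i κ₀ k · x}`. -/
noncomputable def waveChar {n : ℕ} (κ₀ : ℝ) (k : Fin n → ℤ) (x : Fin n → ℝ) : ℂ :=
  Complex.exp (Complex.I * (κ₀ : ℂ) * ∑ j, (k j : ℂ) * (x j : ℂ))

lemma continuous_waveChar {n : ℕ} (κ₀ : ℝ) (k : Fin n → ℤ) : Continuous (waveChar κ₀ k) := by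
  unfold waveChar; fun_prop

lemma conj_waveChar_mul {n : ℕ} (κ₀ : ℝ) (k l : Fin n → ℤ) (x : Fin n → ℝ) :
    (starRingEnd ℂ) (waveChar κ₀ k x) * waveChar κ₀ l x =
      ∏ j, Complex.exp (Complex.I * κ₀ * ((l j - k j : ℤ) : ℂ) * (x j : ℂ)) := by
  rw [waveChar, waveChar, ← Complex.exp_conj, ← Complex.exp_add, ← Complex.exp_sum]
  congr 1
  simp only [map_mul, map_sum, Complex.conj_I, Complex.conj_ofReal, map_intCast, Finset.mul_sum]
  rw [← Finset.sum_add_distrib]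
  refine Finset.sum_congr rfl fun j _ => ?_
  push_cast
  ring

lemma integral_exp_period {κ₀ : ℝ} (hκ₀ : 0 < κ₀) {m : ℤ} (hm : m ≠ 0) :
    ∫ y in Set.Icc (0 : ℝ) (2 * Real.pi / κ₀),
      Complex.exp (Complex.I * κ₀ * (m : ℂ) * (y : ℂ)) = 0 := by
  have hc : Complex.I * κ₀ * (m : ℂ) ≠ 0 := by
    simp [Complex.I_ne_zero, hκ₀.ne', hm]
  rw [MeasureTheory.integral_Icc_eq_integral_Ioc, ← intervalIntegral.integral_of_le (by positivity),
    integral_exp_mul_complex hc]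
  have h1 : Complex.I * κ₀ * (m : ℂ) * ((2 * Real.pi / κ₀ : ℝ) : ℂ) =
      m * (2 * Real.pi * Complex.I) := by
    have : (κ₀ : ℂ) ≠ 0 := by exact_mod_cast hκ₀.ne'
    push_cast
    field_simp
  rw [h1, Complex.exp_int_mul_two_pi_mul_I]
  simp

lemma integral_conj_waveChar_mul {n : ℕ} {κ₀ : ℝ} (hκ₀ : 0 < κ₀) (k l : Fin n → ℤ) :
    ∫ x in Set.Icc (0 : Fin n → ℝ) (fun _ => 2 * Real.pi / κ₀),
      (starRingEnd ℂ) (waveChar κ₀ k x) * waveChar κ₀ l x =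
        if k = l then (((2 * Real.pi / κ₀) ^ n : ℝ) : ℂ) else 0 := by
  simp_rw [conj_waveChar_mul]
  rw [← Set.pi_univ_Icc, MeasureTheory.volume_pi, MeasureTheory.Measure.restrict_pi_pi]
  rw [MeasureTheory.integral_fintype_prod_eq_prod (𝕜 := ℂ)
    (fun j (y : ℝ) => Complex.exp (Complex.I * κ₀ * ((l j - k j : ℤ) : ℂ) * (y : ℂ)))]
  split_ifs with h
  · subst h
    have hL : 0 ≤ 2 * Real.pi / κ₀ := by positivity
    simp [hL, div_pow]
  · obtain ⟨j, hj⟩ := Function.ne_iff.mp h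
    refine Finset.prod_eq_zero (Finset.mem_univ j) ?_
    exact integral_exp_period hκ₀ (sub_ne_zero.mpr (Ne.symm hj))

/-- Parseval's identity for trigonometric polynomials. -/
lemma integral_norm_field_sq {n : ℕ} {κ₀ : ℝ} (hκ₀ : 0 < κ₀) {f : CoeffSeq n}
    {S : Finset (Fin n → ℤ)} (hS : ∀ k ∉ S, f k = 0) :
    ∫ x in Set.Icc (0 : Fin n → ℝ) (fun _ => 2 * Real.pi / κ₀), ‖field κ₀ f x‖ ^ 2 =
      (2 * Real.pi / κ₀) ^ n * ∑ k ∈ S, ‖f k‖ ^ 2 := by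
  have hfield : ∀ x, field κ₀ f x = ∑ k ∈ S, waveChar κ₀ k x • f k := fun x =>
    tsum_eq_sum fun k hk => by rw [hS k hk, smul_zero]
  have hsq : ∀ x, ((‖field κ₀ f x‖ ^ 2 : ℝ) : ℂ) = ∑ k ∈ S, ∑ l ∈ S,
      ((starRingEnd ℂ) (waveChar κ₀ k x) * waveChar κ₀ l x) * inner ℂ (f k) (f l) := fun x => by
    rw [Complex.ofReal_pow]
    have h := inner_self_eq_norm_sq_to_K (𝕜 := ℂ) (field κ₀ f x)
    rw [show ((‖field κ₀ f x‖ : ℂ)) ^ 2 = inner ℂ (field κ₀ f x) (field κ₀ f x) from h.symm, hfield]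
    simp only [sum_inner, inner_sum, inner_smul_left, inner_smul_right]
    rw [Finset.sum_comm]
    refine Finset.sum_congr rfl fun k _ => ?_
    rw [Finset.mul_sum]
    exact Finset.sum_congr rfl fun l _ => by ring
  apply Complex.ofReal_injective
  rw [← integral_complex_ofReal]
  simp_rw [hsq]
  have hi : ∀ k l : Fin n → ℤ, MeasureTheory.IntegrableOn (fun x =>
      ((starRingEnd ℂ) (waveChar κ₀ k x) * waveChar κ₀ l x) * inner ℂ (f k) (f l))
      (Set.Icc (0 : Fin n → ℝ) (fun _ => 2 * Real.pi / κ₀)) := fun k l =>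
    Continuous.integrableOn_Icc (((Complex.continuous_conj.comp (continuous_waveChar κ₀ k)).mul
      (continuous_waveChar κ₀ l)).mul continuous_const)
  rw [MeasureTheory.integral_finsetSum _ fun k _ =>
    MeasureTheory.integrable_finsetSum _ fun l _ => hi k l]
  simp_rw [MeasureTheory.integral_finsetSum S fun l _ => hi _ l,
    MeasureTheory.integral_mul_const, integral_conj_waveChar_mul hκ₀]
  push_cast
  rw [Finset.mul_sum]
  refine Finset.sum_congr rfl fun k hk => ?_
  simp only [ite_mul, zero_mul, Finset.sum_ite_eq, hk, if_true]
  rw [inner_self_eq_norm_sq_to_K]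
  rfl

lemma grashof_nonneg {n : ℕ} {ν κ₀ : ℝ} (hκ₀ : 0 < κ₀) (f : CoeffSeq n) :
    0 ≤ grashof ν κ₀ f := by
  have : 0 ≤ l2Norm κ₀ f := Real.sqrt_nonneg _
  unfold grashof
  positivity

/-- Each Fourier coefficient of a trigonometric polynomial is controlled by the Grashof number; the
factor `(2π)^{-n/2}` is dropped. -/
lemma norm_le_grashof {n : ℕ} {ν κ₀ : ℝ} (hν : 0 < ν) (hκ₀ : 0 < κ₀) {f : CoeffSeq n}
    {S : Finset (Fin n → ℤ)} (hS : ∀ k ∉ S, f k = 0) (k : Fin n → ℤ) :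
    ‖f k‖ ≤ ν ^ 2 * κ₀ ^ 3 * grashof ν κ₀ f := by
  have hG := grashof_nonneg (ν := ν) hκ₀ f
  by_cases hk : k ∈ S
  swap
  · rw [hS k hk, norm_zero]; positivity
  have hl0 : 0 ≤ l2Norm κ₀ f := Real.sqrt_nonneg _
  have hval : ν ^ 2 * κ₀ ^ 3 * grashof ν κ₀ f = κ₀ ^ ((n : ℝ) / 2) * l2Norm κ₀ f := by
    rw [grashof]; field_simp
  have hpow : (κ₀ ^ ((n : ℝ) / 2)) ^ 2 = κ₀ ^ n := by
    rw [← Real.rpow_natCast, ← Real.rpow_mul hκ₀.le, ← Real.rpow_natCast]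
    congr 1
    push_cast
    ring
  have hl2 : l2Norm κ₀ f ^ 2 = (2 * Real.pi / κ₀) ^ n * ∑ k ∈ S, ‖f k‖ ^ 2 := by
    rw [l2Norm, Real.sq_sqrt (MeasureTheory.integral_nonneg fun x => by positivity),
      integral_norm_field_sq hκ₀ hS]
  rw [hval]
  refine le_of_sq_le_sq ?_ (by positivity)
  rw [mul_pow, hpow, hl2, ← mul_assoc, ← mul_pow, mul_div_cancel₀ _ hκ₀.ne']
  have h1 : ‖f k‖ ^ 2 ≤ ∑ k ∈ S, ‖f k‖ ^ 2 :=
    Finset.single_le_sum (f := fun k => ‖f k‖ ^ 2) (fun _ _ => by positivity) hk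
  have h2 : (1 : ℝ) ≤ (2 * Real.pi) ^ n := one_le_pow₀ (by linarith [Real.pi_gt_three])
  exact h1.trans (le_mul_of_one_le_left (Finset.sum_nonneg fun _ _ => by positivity) h2)

/-- A box of integer vectors that contains every `k` with `|k| ≤ r`. -/
noncomputable def waveBox (n : ℕ) (r : ℝ) : Finset (Fin n → ℤ) :=
  Finset.Icc (fun _ => -⌊r⌋) (fun _ => ⌊r⌋)

lemma mem_waveBox {n : ℕ} {r : ℝ} {k : Fin n → ℤ} (hk : waveAbs k ≤ r) : k ∈ waveBox n r := by
  have h : ∀ j, |(k j : ℝ)| ≤ r := fun j => by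
    refine le_trans ?_ hk
    rw [waveAbs, ← Real.sqrt_sq_eq_abs]
    exact Real.sqrt_le_sqrt (Finset.single_le_sum (f := fun j => (k j : ℝ) ^ 2)
      (fun _ _ => sq_nonneg _) (Finset.mem_univ j))
  rw [waveBox, Finset.mem_Icc]
  refine ⟨fun j => ?_, fun j => ?_⟩
  · have := Int.le_floor.mpr (show ((-k j : ℤ) : ℝ) ≤ r by
      push_cast; linarith [neg_le_abs (k j : ℝ), h j])
    simp only
    omega
  · exact Int.le_floor.mpr ((le_abs_self _).trans (h j))

end NavierStokesTorus

/-! ### Choice of the time and of the growth rate of the weight -/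

open NavierStokesTorus in
theorem mainTheorem3 (n : ℕ) (hn : 2 ≤ n) (κ₀ : ℝ) (hκ₀ : 0 < κ₀) (κb : ℝ)
    (C : ℝ) (hC : 0 < C) :
    ∃ c : ℝ, 0 < c ∧
      ∀ (ν : ℝ), 0 < ν →
      ∀ (f u₀ : NavierStokesTorus.CoeffSeq n),
        f ∈ NavierStokesTorus.DivFree n →
        NavierStokesTorus.truncModes κ₀ κb f = f →
        u₀ ∈ NavierStokesTorus.DivFree n →
        NavierStokesTorus.wienerNorm ν κ₀ u₀ ≤
          ENNReal.ofReal (C * NavierStokesTorus.grashof ν κ₀ f ^ (1 / 2 : ℝ)) →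
        ∃ T : ℝ, 0 < T ∧ T < (ν * κ₀ ^ 2)⁻¹ ∧
          ∃ u : ℝ → NavierStokesTorus.CoeffSeq n,
            NavierStokesTorus.IsWeakSolution ν κ₀ T f u₀ u ∧
            NavierStokesTorus.ContinuousIntoSob κ₀ 0 T u ∧
            (∀ v : ℝ → NavierStokesTorus.CoeffSeq n,
              NavierStokesTorus.IsWeakSolution ν κ₀ T f u₀ v →
              NavierStokesTorus.ContinuousIntoSob κ₀ 0 T v →
              ∀ t ∈ Set.Icc 0 T, v t = u t) ∧
            NavierStokesTorus.GevreyRegular κ₀ T u ∧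
            ENNReal.ofReal (c * κ₀⁻¹ *
                (max 1 (NavierStokesTorus.grashof ν κ₀ f)) ^ (-(1 / 2) : ℝ)) ≤
              NavierStokesTorus.analyticityRadius κ₀ 0 (u T) := by
  set q : ℝ := |κb / κ₀| with hq
  set N : ℝ := ((waveBox n (κb / κ₀)).card : ℝ) with hN
  have hN0 : 0 ≤ N := Nat.cast_nonneg _
  set A : ℝ := 2 * C + Real.exp q * N with hA
  have hA0 : 0 ≤ A := by positivity
  set ε : ℝ := 1 / (40 * (A + 1)) with hε
  have hε0 : 0 < ε := by positivity
  have hε1 : ε < 1 := by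
    rw [hε, div_lt_one (by positivity)]; linarith
  have hεA : ε * A ≤ 1 / 40 := by
    rw [hε, div_mul_eq_mul_div, div_le_div_iff₀ (by positivity) (by norm_num)]; linarith
  refine ⟨ε, hε0, fun ν hν f u₀ hf hfκ hu₀ hu₀G => ?_⟩
  set G : ℝ := grashof ν κ₀ f with hGdef
  have hG0 : 0 ≤ G := grashof_nonneg hκ₀ f
  -- `g = √(max 1 G)`, and `δ = ε / g` is the square root of the dimensionless time `ν κ₀² T`.
  set g : ℝ := Real.sqrt (max 1 G) with hg
  have hm1 : 1 ≤ max 1 G := le_max_left _ _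
  have hgsq : g ^ 2 = max 1 G := Real.sq_sqrt (by linarith)
  have hg1 : 1 ≤ g := by rw [hg]; exact Real.one_le_sqrt.mpr hm1
  have hg0 : 0 < g := by linarith
  have hGg : Real.sqrt G ≤ g := Real.sqrt_le_sqrt (le_max_right _ _)
  have hGg2 : G ≤ g ^ 2 := hgsq ▸ le_max_right _ _
  set δ : ℝ := ε / g with hδ
  have hδ0 : 0 < δ := by positivity
  have hδε : δ ≤ ε := div_le_self hε0.le hg1
  have hδg : δ * g = ε := by rw [hδ]; field_simp
  set T : ℝ := δ ^ 2 / (ν * κ₀ ^ 2) with hT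
  have hT0 : 0 < T := by positivity
  set α : ℝ := ν * κ₀ / δ with hα
  have hα0 : 0 < α := by positivity
  have hαT : α * T = δ / κ₀ := by rw [hα, hT]; field_simp
  have hα2T : α ^ 2 * T ≤ ν := le_of_eq (by rw [hα, hT]; field_simp)
  have hsqrtT : Real.sqrt (T / ν) = δ / (ν * κ₀) := by
    rw [show T / ν = (δ / (ν * κ₀)) ^ 2 by rw [hT]; field_simp]
    exact Real.sqrt_sq (by positivity)
  have hsupp : ∀ k, f k ≠ 0 → waveAbs k ≤ κb / κ₀ := fun k hk => by
    by_contra hlt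
    apply hk
    rw [← hfκ, truncModes, if_neg hlt]
  have hS : ∀ k ∉ waveBox n (κb / κ₀), f k = 0 := fun k hk => by
    by_contra hne
    exact hk (mem_waveBox (hsupp k hne))
  have hfs : Summable fun k => ‖f k‖ :=
    summable_of_ne_finset_zero (s := waveBox n (κb / κ₀)) fun k hk => by rw [hS k hk, norm_zero]
  have hfsum : ∑' k, ‖f k‖ ≤ N * (ν ^ 2 * κ₀ ^ 3 * G) := by
    rw [tsum_eq_sum (s := waveBox n (κb / κ₀)) fun k hk => by rw [hS k hk, norm_zero]]
    refine (Finset.sum_le_card_nsmul _ _ _ fun k _ => norm_le_grashof hν hκ₀ hS k).trans ?_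
    rw [nsmul_eq_mul]
  have hνκ : 0 < ν * κ₀ := by positivity
  have hu₀le : ∑' k, ‖u₀ k‖ₑ ≤ ENNReal.ofReal (ν * κ₀ * (C * g)) := by
    rw [wienerNorm, sobNorm_zero, ENNReal.ofReal_inv_of_pos hνκ,
      ENNReal.inv_mul_le_iff (by simpa using hνκ) ENNReal.ofReal_ne_top,
      ← ENNReal.ofReal_mul hνκ.le, ← Real.sqrt_eq_rpow] at hu₀G
    refine hu₀G.trans (ENNReal.ofReal_le_ofReal ?_)
    gcongr
  have hu₀s : Summable fun k => ‖u₀ k‖ :=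
    summable_norm_of_tsum_enorm_ne_top (ne_top_of_le_ne_top ENNReal.ofReal_ne_top hu₀le)
  have hu₀sum : ∑' k, ‖u₀ k‖ ≤ ν * κ₀ * (C * g) := by
    rw [tsum_enorm_eq_ofReal hu₀s] at hu₀le
    exact (ENNReal.ofReal_le_ofReal_iff (by positivity)).mp hu₀le
  have hfQ : ∀ k, f k ≠ 0 → α * (κ₀ * waveAbs k) * T ≤ q := fun k hk => by
    have h1 : α * (κ₀ * waveAbs k) * T = δ * waveAbs k := by
      rw [show α * (κ₀ * waveAbs k) * T = α * T * κ₀ * waveAbs k by ring, hαT]; field_simp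
    rw [h1]
    have h2 := (hsupp k hk).trans (le_abs_self _)
    have h3 : δ * waveAbs k ≤ 1 * waveAbs k :=
      mul_le_mul_of_nonneg_right (hδε.trans hε1.le) (waveAbs_nonneg k)
    linarith
  -- The free evolution and the force together are at most `ν κ₀ A g`: the force contributes
  -- `T ν² κ₀³ G = ν κ₀ δ² G`, and `δ² G ≤ ε² ≤ g`.
  have hdata : 2 * (∑' k, ‖u₀ k‖) + T * (Real.exp q * ∑' k, ‖f k‖) ≤ 2 * (ν * κ₀ * A * g) / 2 := by
    have h1 : T * (Real.exp q * ∑' k, ‖f k‖) ≤ ν * κ₀ * (Real.exp q * N) * g := by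
      calc T * (Real.exp q * ∑' k, ‖f k‖)
          ≤ T * (Real.exp q * (N * (ν ^ 2 * κ₀ ^ 3 * G))) := by gcongr
        _ = ν * κ₀ * (Real.exp q * N) * (δ ^ 2 * G) := by rw [hT]; field_simp
        _ ≤ ν * κ₀ * (Real.exp q * N) * g := by
            gcongr
            have h2 : δ ^ 2 * G ≤ δ ^ 2 * g ^ 2 := by gcongr
            rw [← mul_pow, hδg] at h2
            nlinarith
    rw [hA]
    nlinarith
  have hbR : 5 * Real.sqrt (T / ν) * (2 * (ν * κ₀ * A * g)) ≤ 1 / 4 := by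
    have : 5 * Real.sqrt (T / ν) * (2 * (ν * κ₀ * A * g)) = 10 * ((δ * g) * A) := by
      rw [hsqrtT]; field_simp; ring
    rw [this, hδg]
    linarith
  obtain ⟨U, hU, hUr⟩ := exists_mild_solution hν hκ₀.le hα0.le hT0.le hα2T hfQ
    (neg_eq_conj_of_mem_divFree hf) (neg_eq_conj_of_mem_divFree hu₀) hfs hu₀s (by positivity) hbR hdata
  have hsol := isWeakSolution_unweight hκ₀.le hα0.le hT0.le hf hu₀ hU hUr
  have hcont := continuousIntoSob_unweight (T := T) hκ₀.le hα0.le U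
    (unweight_mem_divFree hκ₀.le hα0.le hf hu₀ hU hUr)
  refine ⟨T, hT0, ?_, unweight κ₀ α T U, hsol, hcont,
    fun v hv hv' => hv.unique hν hκ₀ hT0.le hsol hv' hcont, gevreyRegular_unweight hα0 U, ?_⟩
  · rw [hT, ← one_div]
    exact div_lt_div_of_pos_right (pow_lt_one₀ hδ0.le (hδε.trans_lt hε1) two_ne_zero) (by positivity)
  · refine le_trans (le_of_eq ?_) (le_analyticityRadius_unweight hα0 hT0 U)
    rw [hαT, Real.rpow_neg (by linarith), ← Real.sqrt_eq_rpow, ← hg, hδ]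
    congr 1
    field_simp
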